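/- Let $k\ge 3$. A $k$-uniform hypergraph $G$ has a vertex set $V(G)$ and a set $E(G)$ of $k$-element subsets of $V(G)$; its minimum codegree $\delta_{k-1}(G)$ is the minimum, over all $(k-1)$-subsets $S$ of $V(G)$, of the number of vertices $v$ with $S\cup\{v\}\in E(G)$. For a $k$-uniform hypergraph $F$, let $\mathrm{ex}_{k-1}(n,F)$ be the largest $\delta_{k-1}(G)$ over all $k$-uniform hypergraphs $G$ on $n$ vertices containing no copy of $F$, and let $\gamma(F)=\lim_{n\to\infty}\mathrm{ex}_{k-1}(n,F)/n$ be its codegree Turán density. For $\ell>k$, the tight cycle $C^k_\ell$ has vertices $v_1,\dots,v_\ell$ and edges $\{v_i,v_{i+1},\dots,v_{i+k-1}\}$ for $1\le i\le \ell$, with indices modulo $\ell$. A set $S$ of positive integers has natural density $d$ if $|S\cap\{1,\dots,N\}|/N\to d$ as $N\to\infty$. Let $\varphi$ be Euler's totient function. In each statement below, the existence of the limit defining $\gamma(C^k_\ell)$ is part of the claim. (a) For every prime $k\ge 3$ and every $\ell\ge 20k^2$ with $k\nmid \ell$, $\gamma(C^k_\ell)=\tfrac13$. (b) Let $k\ge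 3$ be an integer of the form $2^\alpha 3^\beta$ (with integers $\alpha,\beta\ge 0$), $2q$ or $3q$, with $q$ prime. Then for every $\ell\ge 20k^2$ with $k\nmid\ell$, $$\gamma(C^k_\ell)=\begin{cases}\tfrac12 & \text{if } k/\gcd(k,\ell)\text{ is even},\\ \tfrac13 & \text{if } k/\gcd(k,\ell)\text{ is odd}.\end{cases}$$ (c) For every integer $k\ge 3$, the set of integers $\ell\ge 20k^2$ with $\gcd(k,\ell)=1$ has natural density $\varphi(k)/k$, and every $\ell$ in it satisfies $k\nmid\ell$ and $$\gamma(C^k_\ell)=\begin{cases}\tfrac12 & \text{if } k\text{ is even},\\ \tfrac13 & \text{if } k\text{ is odd}.\end{cases}$$ -/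

import Mathlib

open Filter Topology

/-- A `k`-uniform hypergraph with vertex set the whole type `V`:
a set of edges, each of which is a `k`-element subset of `V`. -/
@[ext]
structure KGraph (V : Type*) (k : ℕ) where
  /-- the edge set -/
  edges : Set (Finset V)
  /-- every edge has exactly `k` vertices -/
  card_eq : ∀ e ∈ edges, e.card = k

namespace KGraph

/-- `G` contains a copy of `F`: there is an injection of the vertices of `F` into the vertices of
`G` that sends every edge of `F` to an edge of `G`. -/
def ContainsCopy {V W : Type*} {k : ℕ} (G : KGraph V k) (F : KGraph W k) : Prop :=
  ∃ f : W ↪ V, ∀ e ∈ F.edges, e.map f ∈ G.edges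

/-- The neighbourhood `N_G(S) = {v : S ∪ {v} ∈ E(G)}`. -/
def nbhd {V : Type*} [DecidableEq V] {k : ℕ} (G : KGraph V k) (S : Finset V) : Set V :=
  {v | insert v S ∈ G.edges}

/-- The codegree `|N_G(S)|`. -/
noncomputable def codegree {V : Type*} [DecidableEq V] {k : ℕ} (G : KGraph V k)
    (S : Finset V) : ℕ :=
  (G.nbhd S).ncard

/-- The minimum codegree `δ_{k-1}(G)`: the minimum of the codegrees of the `(k-1)`-subsets of the
vertex set. -/
noncomputable def minCodegree {V : Type*} [DecidableEq V] {k : ℕ} (G : KGraph V k) : ℕ :=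
  ⨅ S : {S : Finset V // S.card = k - 1}, G.codegree S.1

/-- The codegree Turán number `ex_{k-1}(n, F)`: the largest minimum codegree of a `k`-uniform
hypergraph on `n` vertices that contains no copy of `F`. -/
noncomputable def exCodegree {W : Type*} {k : ℕ} (n : ℕ) (F : KGraph W k) : ℕ :=
  sSup {d : ℕ | ∃ G : KGraph (Fin n) k, ¬ G.ContainsCopy F ∧ G.minCodegree = d}

/-- `F` has codegree Turán density `γ(F) = c`: the limit of `ex_{k-1}(n, F) / n` as `n → ∞` exists
and equals `c`. -/
def HasCodegreeTuranDensity {W : Type*} {k : ℕ} (F : KGraph W k) (c : ℝ) : Prop :=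
  Tendsto (fun n : ℕ => (exCodegree n F : ℝ) / (n : ℝ)) atTop (𝓝 c)

/-- The tight cycle `C^k_ℓ`: its vertices are the residues modulo `ℓ`, and its edges are the sets
`{i, i + 1, …, i + k - 1}`. (For `k ≤ ℓ` these automatically have `k` elements, see
`mem_tightCycle_edges`.) -/
def tightCycle (k ℓ : ℕ) : KGraph (ZMod ℓ) k where
  edges := {e | e.card = k ∧
    ∃ i : ZMod ℓ, e = (Finset.range k).image (fun j : ℕ => i + (j : ZMod ℓ))}
  card_eq := fun _ he => he.1

theorem mem_tightCycle_edges {k ℓ : ℕ} (h : k ≤ ℓ) (e : Finset (ZMod ℓ)) :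
    e ∈ (tightCycle k ℓ).edges ↔
      ∃ i : ZMod ℓ, e = (Finset.range k).image (fun j : ℕ => i + (j : ZMod ℓ)) := by
  refine ⟨fun he => he.2, fun he => ⟨?_, he⟩⟩
  obtain ⟨i, rfl⟩ := he
  rw [Finset.card_image_of_injOn, Finset.card_range]
  intro a ha b hb hab
  have ha' : a < ℓ := lt_of_lt_of_le (by simpa using ha) h
  have hb' : b < ℓ := lt_of_lt_of_le (by simpa using hb) h
  have hab' : (a : ZMod ℓ) = (b : ZMod ℓ) := add_left_cancel hab
  rw [ZMod.natCast_eq_natCast_iff'] at hab'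
  rwa [Nat.mod_eq_of_lt ha', Nat.mod_eq_of_lt hb'] at hab'

end KGraph

/-- The set `S` of natural numbers has natural density `d`:
`|S ∩ {1, …, N}| / N → d` as `N → ∞`. -/
def HasNaturalDensity (S : Set ℕ) (d : ℝ) : Prop :=
  Tendsto (fun N : ℕ => ((S ∩ Set.Icc 1 N).ncard : ℝ) / (N : ℝ)) atTop (𝓝 d)

set_option linter.unusedSectionVars false

namespace KGraph

/-! Write g = gcd(k, ℓ) and d = k / g.

Upper bounds. It is enough to find closed tight walks of length ℓ: a random sample of a large
hypergraph keeps its relative codegree, so one walk pattern recurs with positive density, and a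
dense family of tuples contains a box in which the walk unfolds to a cycle
(`eventually_containsCopy`). To build a walk, place an edge in k cyclic slots and read the slots
round and round, changing at most one vertex per round; it closes up if ⌊ℓ/k⌋ such moves turn the
arrangement into its rotation by ℓ (`exists_closedWalk_of_reach`). Two vertices of an edge can be
exchanged in three moves if the (k-1)-sets left by removing either one have a common neighbour.
Above codegree n/2 this always holds; above n/3 it holds for some pair among any three vertices of
an edge. In the latter case, either some edge admits every exchange within 20 moves, and 20k² ≤ ℓ
leaves room for the rotation, or having such a common neighbour is an equivalence relation with two
classes on every edge, and whether u, v lie in different classes of e depends only on e ∖ {u, v}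
(`DenseThird.splitting_cross`). Classes can then be enlarged two vertices at a time
(`Splitting.exists_class_add_two`) but never fill an edge, so every odd divisor of k is a class
size. If d is odd, a class of size d placed on the slots divisible by g is preserved by the
rotation, which is again reachable.

Lower bounds. Give the vertices types in ℤ/p and take as edges the k-sets of type sum 1. Along a
tight cycle a constant sum forces the types to have period k, so each type occurs in each window a
multiple of d times; if p ∣ d the sum would be 0 (`le_exCodegree_of_dvd`). If g ≤ 3 < d, three types
still work once the distributions divisible by d are replaced with nearby ones
(`le_exCodegree_of_gcd_le`). The arithmetic conditions on k ensure that one of the constructions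
applies. -/

theorem notMem_of_insert_mem {V : Type*} [DecidableEq V] {k : ℕ} {G : KGraph V k} {S : Finset V}
    {v : V} (hS : S.card < k)
    (h : insert v S ∈ G.edges) : v ∉ S := by
  intro hv
  have := G.card_eq _ h
  rw [Finset.insert_eq_of_mem hv] at this
  omega

/-! ### Neighbourhoods and the pigeonhole above codegree n/3. -/

section Neighbours

variable {V : Type*} [Fintype V] [DecidableEq V] {k : ℕ}

open Classical in
/-- The neighbourhood of a set as a `Finset`. -/
noncomputable def nbr (G : KGraph V k) (S : Finset V) : Finset V :=
  Finset.univ.filter fun v => insert v S ∈ G.edges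

theorem mem_nbr {G : KGraph V k} {S : Finset V} {v : V} :
    v ∈ G.nbr S ↔ insert v S ∈ G.edges := by
  simp [nbr]

theorem card_nbr (G : KGraph V k) (S : Finset V) : (G.nbr S).card = G.codegree S := by
  rw [codegree, ← Set.ncard_coe_finset]
  congr 1
  ext v
  simp [mem_nbr, nbhd]

theorem distinct_of_insert_two {G : KGraph V k} {T : Finset V} {u v : V} (hT : T.card + 2 = k)
    (h : insert u (insert v T) ∈ G.edges) : u ≠ v ∧ u ∉ T ∧ v ∉ T := by
  have h1 := G.card_eq _ h
  have h2 := Finset.card_insert_le u (insert v T)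
  have h3 := Finset.card_insert_le v T
  have hu : u ∉ insert v T := notMem_of_insert_mem (by omega) h
  have hv : v ∉ T := by
    intro hv
    rw [Finset.insert_eq_of_mem hv] at h2 h1
    omega
  simp only [Finset.mem_insert, not_or] at hu
  exact ⟨hu.1, hu.2, hv⟩

theorem distinct_of_insert_three {G : KGraph V k} {R : Finset V} {u v w : V}
    (hR : R.card + 3 = k) (h : insert u (insert v (insert w R)) ∈ G.edges) :
    u ≠ v ∧ u ≠ w ∧ v ≠ w ∧ u ∉ R ∧ v ∉ R ∧ w ∉ R := by
  have h1 := G.card_eq _ h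
  have h2 := Finset.card_insert_le u (insert v (insert w R))
  have h3 := Finset.card_insert_le v (insert w R)
  have h4 := Finset.card_insert_le w R
  have hw : w ∉ R := by
    intro hw
    rw [Finset.insert_eq_of_mem hw] at h2 h1 h3
    omega
  have := distinct_of_insert_two (T := insert w R)
    (by rw [Finset.card_insert_of_notMem hw]; omega) h
  simp only [Finset.mem_insert, not_or] at this
  tauto

/-- All codegrees are at least `δ`, where `3 * δ` exceeds the number of vertices. -/
structure DenseThird (G : KGraph V k) (δ : ℕ) : Prop where
  deg : ∀ S : Finset V, S.card + 1 = k → δ ≤ (G.nbr S).card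
  three_le : 3 ≤ k
  le_card : k ≤ Fintype.card V
  two_le : 2 ≤ δ
  card_lt : Fintype.card V < 3 * δ

theorem DenseThird.exists_ne {G : KGraph V k} {δ : ℕ} (hG : G.DenseThird δ) {S : Finset V}
    (hS : S.card + 1 = k) (x : V) : ∃ y, y ≠ x ∧ insert y S ∈ G.edges := by
  have h1 : 1 < (G.nbr S).card := lt_of_lt_of_le hG.two_le (hG.deg S hS)
  obtain ⟨y, hy, hyx⟩ := Finset.exists_mem_ne h1 x
  exact ⟨y, hyx, mem_nbr.1 hy⟩

theorem DenseThird.exists_nbr {G : KGraph V k} {δ : ℕ} (hG : G.DenseThird δ) {S : Finset V}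
    (hS : S.card + 1 = k) : ∃ y, insert y S ∈ G.edges := by
  have h1 : 0 < (G.nbr S).card := lt_of_lt_of_le (by have := hG.two_le; omega) (hG.deg S hS)
  obtain ⟨y, hy⟩ := Finset.card_pos.1 h1
  exact ⟨y, mem_nbr.1 hy⟩

/-- Two sets of vertices have a common neighbour. -/
def Meet (G : KGraph V k) (S S' : Finset V) : Prop :=
  ∃ y, insert y S ∈ G.edges ∧ insert y S' ∈ G.edges

theorem Meet.symm {G : KGraph V k} {S S' : Finset V} (h : G.Meet S S') : G.Meet S' S := by
  obtain ⟨y, h1, h2⟩ := h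
  exact ⟨y, h2, h1⟩

/-- Three pairwise disjoint neighbourhoods would occupy `3 * δ` vertices, more than there are. -/
theorem DenseThird.meet {G : KGraph V k} {δ : ℕ} (hG : G.DenseThird δ) {S₁ S₂ S₃ : Finset V}
    (h₁ : S₁.card + 1 = k) (h₂ : S₂.card + 1 = k) (h₃ : S₃.card + 1 = k) :
    G.Meet S₁ S₂ ∨ G.Meet S₁ S₃ ∨ G.Meet S₂ S₃ := by
  by_contra! hcon
  obtain ⟨h12, h13, h23⟩ := hcon
  have key : ∀ S S' : Finset V, ¬ G.Meet S S' → Disjoint (G.nbr S) (G.nbr S') := by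
    intro S S' h
    rw [Finset.disjoint_left]
    intro y hy hy'
    exact h ⟨y, mem_nbr.1 hy, mem_nbr.1 hy'⟩
  have hd : Disjoint (G.nbr S₁ ∪ G.nbr S₂) (G.nbr S₃) :=
    Finset.disjoint_union_left.2 ⟨key _ _ h13, key _ _ h23⟩
  have h := Finset.card_le_univ ((G.nbr S₁ ∪ G.nbr S₂) ∪ G.nbr S₃)
  rw [Finset.card_union_of_disjoint hd, Finset.card_union_of_disjoint (key _ _ h12)] at h
  have := hG.deg _ h₁
  have := hG.deg _ h₂
  have := hG.deg _ h₃
  have := hG.card_lt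
  omega

end Neighbours

/-! ### Splittings of edges into two classes, and their link graphs. -/

section Parity

variable {V : Type*} [Fintype V] [DecidableEq V] {k : ℕ}

/-- A family `X` of `(k - 2)`-sets that induces on every edge a partition of the edge into two
nonempty classes: two vertices `u`, `v` of an edge `e` lie in different classes
if and only if `e \ {u, v}` belongs to `X`. -/
structure Splitting (G : KGraph V k) (X : Finset V → Prop) : Prop where
  even : ∀ (R : Finset V) (u v w : V), R.card + 3 = k →
    insert u (insert v (insert w R)) ∈ G.edges →
    (X (insert u R) ↔ ¬ (X (insert v R) ↔ X (insert w R)))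
  proper : ∀ e ∈ G.edges, ∃ (T : Finset V) (u v : V), T.card + 2 = k ∧
    e = insert u (insert v T) ∧ X T

variable {G : KGraph V k} {δ : ℕ} {X : Finset V → Prop}

/-- As `X` misses `insert x R`, the vertices `v` and `w` share a class, so `x` is separated from
both or from neither. Hence `fun v => X (insert v R)` is constant along the edges of the link graph
of `insert x R`. -/
theorem Splitting.link_iff (hX : G.Splitting X) {R : Finset V} {x v w : V} (hR : R.card + 3 = k)
    (hx : ¬ X (insert x R)) (h : insert v (insert w (insert x R)) ∈ G.edges) :
    X (insert v R) ↔ X (insert w R) := by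
  have := hX.even R v w x hR h
  tauto

/-- In a link graph, two properties that are invariant along edges and both
non-constant are equal or complementary. -/
theorem DenseThird.two_values (hG : G.DenseThird δ) {T : Finset V} (hT : T.card + 2 = k)
    {P P' : V → Prop}
    (hP : ∀ u v, insert u (insert v T) ∈ G.edges → (P u ↔ P v))
    (hP' : ∀ u v, insert u (insert v T) ∈ G.edges → (P' u ↔ P' v))
    {a b c : V} (ha : a ∉ T) (hb : b ∉ T) (hc : c ∉ T) :
    ((P a ↔ P b) ∧ (P' a ↔ P' b)) ∨ ((P a ↔ P c) ∧ (P' a ↔ P' c)) ∨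
      ((P b ↔ P c) ∧ (P' b ↔ P' c)) := by
  have key : ∀ a b, G.Meet (insert a T) (insert b T) → (P a ↔ P b) ∧ (P' a ↔ P' b) := by
    rintro a b ⟨y, h1, h2⟩
    have := hP _ _ h1
    have := hP _ _ h2
    have := hP' _ _ h1
    have := hP' _ _ h2
    tauto
  have hcard : ∀ a, a ∉ T → (insert a T).card + 1 = k := by
    intro a ha
    rw [Finset.card_insert_of_notMem ha]; omega
  rcases hG.meet (hcard a ha) (hcard b hb) (hcard c hc) with h | h | h
  · exact Or.inl (key _ _ h)
  · exact Or.inr (Or.inl (key _ _ h))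
  · exact Or.inr (Or.inr (key _ _ h))

/-- A common neighbour `w` of `v`, `x` and `R` takes the same value as `v`. By evenness every vertex
`y` completing `w`, `v` and `R` to an edge then has the opposite value, and there are at least two
of them, so one avoids `x`. -/
theorem Splitting.exists_not (hX : G.Splitting X) (hG : G.DenseThird δ) {R : Finset V} {x v : V}
    (hR : R.card + 3 = k) (hx : ¬ X (insert x R)) (hxR : x ∉ R) (hvR : v ∉ R)
    (hv : X (insert v R)) : ∃ y, y ≠ x ∧ y ∉ R ∧ ¬ X (insert y R) := by
  have hvx : v ≠ x := by rintro rfl; exact hx hv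
  have c1 : (insert v (insert x R)).card + 1 = k := by
    rw [Finset.card_insert_of_notMem (by simp [hvx, hvR]), Finset.card_insert_of_notMem hxR]
    omega
  obtain ⟨w, hw⟩ := hG.exists_nbr c1
  have hw' := hX.link_iff hR hx hw
  obtain ⟨d1, d2, d3, d4, d5, d6⟩ := distinct_of_insert_three hR hw
  have c2 : (insert w (insert v R)).card + 1 = k := by
    rw [Finset.card_insert_of_notMem (by simp [d1, d4]), Finset.card_insert_of_notMem hvR]
    omega
  obtain ⟨y, hyx, hy⟩ := hG.exists_ne c2 x
  have := hX.even R y w v hR hy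
  refine ⟨y, hyx, (distinct_of_insert_three hR hy).2.2.2.1, by tauto⟩

/-- Three vertices of an edge, in terms of complements of pairs. -/
theorem Splitting.even_sdiff (hX : G.Splitting X) {e : Finset V} (he : e ∈ G.edges) {a b c : V}
    (ha : a ∈ e) (hb : b ∈ e) (hc : c ∈ e) (hab : a ≠ b) (hac : a ≠ c) (hbc : b ≠ c) :
    X (e \ {b, c}) ↔ ¬ (X (e \ {a, c}) ↔ X (e \ {a, b})) := by
  have hcard := G.card_eq e he
  have hsub : ({a, b, c} : Finset V) ⊆ e := by
    intro x hx
    simp only [Finset.mem_insert, Finset.mem_singleton] at hx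
    rcases hx with rfl | rfl | rfl <;> assumption
  have h3 : ({a, b, c} : Finset V).card = 3 := Finset.card_eq_three.2 ⟨a, b, c, hab, hac, hbc, rfl⟩
  have hR : (e \ {a, b, c}).card + 3 = k := by
    have := Finset.card_sdiff_add_card_eq_card hsub
    omega
  have h := hX.even (e \ {a, b, c}) a b c hR
    (by convert he using 1; ext x; simp only [Finset.mem_insert, Finset.mem_sdiff,
          Finset.mem_singleton]; grind)
  have e1 : insert a (e \ {a, b, c}) = e \ {b, c} := by
    ext x; simp only [Finset.mem_insert, Finset.mem_sdiff, Finset.mem_singleton]; grind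
  have e2 : insert b (e \ {a, b, c}) = e \ {a, c} := by
    ext x; simp only [Finset.mem_insert, Finset.mem_sdiff, Finset.mem_singleton]; grind
  have e3 : insert c (e \ {a, b, c}) = e \ {a, b} := by
    ext x; simp only [Finset.mem_insert, Finset.mem_sdiff, Finset.mem_singleton]; grind
  rwa [e1, e2, e3] at h

theorem insert_two_sdiff {T : Finset V} {u v : V} (hu : u ∉ T) (hv : v ∉ T) :
    insert u (insert v T) \ {u, v} = T := by
  ext x; simp only [Finset.mem_insert, Finset.mem_sdiff, Finset.mem_singleton]; grind

theorem Splitting.proper_sdiff (hX : G.Splitting X) {e : Finset V} (he : e ∈ G.edges) :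
    ∃ a ∈ e, ∃ b ∈ e, a ≠ b ∧ X (e \ {a, b}) := by
  obtain ⟨T, u, v, hT, rfl, hXT⟩ := hX.proper e he
  obtain ⟨h1, h2, h3⟩ := distinct_of_insert_two hT he
  exact ⟨u, by simp, v, by simp, h1, by rwa [insert_two_sdiff h2 h3]⟩

/-- Every vertex of an edge is separated from another vertex. -/
theorem Splitting.exists_separated (hX : G.Splitting X) {e : Finset V} (he : e ∈ G.edges) {x : V}
    (hx : x ∈ e) : ∃ s ∈ e, s ≠ x ∧ X (e \ {x, s}) := by
  obtain ⟨a, ha, b, hb, hab, h⟩ := hX.proper_sdiff he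
  by_cases hax : a = x
  · subst hax; exact ⟨b, hb, hab.symm, h⟩
  by_cases hbx : b = x
  · subst hbx; exact ⟨a, ha, hab, by rwa [Finset.pair_comm]⟩
  have := hX.even_sdiff he hx ha hb (Ne.symm hax) (Ne.symm hbx) hab
  by_cases h' : X (e \ {x, a})
  · exact ⟨a, ha, hax, h'⟩
  · exact ⟨b, hb, hbx, by tauto⟩

/-- The link graph of `T` is disconnected. In an edge `{w, v} ∪ T` some `s` is separated from `w`;
it is not `v` because `X` misses `T`, so it lies in `T`, and being separated from `s` is an
invariant of the link graph that takes both values. -/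
theorem Splitting.exists_separation (hX : G.Splitting X) (hG : G.DenseThird δ) {T : Finset V}
    (hT : T.card + 2 = k) (hXT : ¬ X T) :
    ∃ P : V → Prop, (∀ u v, insert u (insert v T) ∈ G.edges → (P u ↔ P v)) ∧
      (∃ u, u ∉ T ∧ P u) ∧ ∃ u, u ∉ T ∧ ¬ P u := by
  obtain ⟨v, hv⟩ : ∃ v, v ∉ T := by
    by_contra! h
    have h2 := Finset.card_le_card (fun v _ => h v : Finset.univ ⊆ T)
    have := hG.le_card
    rw [Finset.card_univ] at h2
    omega
  obtain ⟨w, hw⟩ := hG.exists_nbr (S := insert v T)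
    (by rw [Finset.card_insert_of_notMem hv]; omega)
  obtain ⟨hwv, hwT, -⟩ := distinct_of_insert_two hT hw
  obtain ⟨s, hs, hsw, hXs⟩ := hX.exists_separated hw (x := w) (by simp)
  have hsv : s ≠ v := by
    rintro rfl
    rw [insert_two_sdiff hwT hv] at hXs
    exact hXT hXs
  have hsT : s ∈ T := by simpa [hsw, hsv] using hs
  have hR : (T.erase s).card + 3 = k := by
    have := Finset.card_erase_add_one hsT
    omega
  have hTs : insert s (T.erase s) = T := Finset.insert_erase hsT
  have hv' : X (insert v (T.erase s)) := by
    convert hXs using 1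
    ext x; simp only [Finset.mem_insert, Finset.mem_sdiff, Finset.mem_singleton,
      Finset.mem_erase]; grind
  refine ⟨fun u => X (insert u (T.erase s)), ?_, ⟨v, hv, hv'⟩, ?_⟩
  · intro u u' h
    exact hX.link_iff hR (x := s) (by rwa [hTs]) (by rwa [hTs])
  · obtain ⟨y, hys, hyR, hy⟩ := hX.exists_not hG (R := T.erase s) (x := s) (v := v) hR
      (by rwa [hTs]) (by simp) (by simp [hv]) hv'
    exact ⟨y, by simpa [hys] using hyR, hy⟩

set_option maxHeartbeats 1000000 in
open Classical in
/-- Counting triples of vertices: it is impossible that the link graphs of all the sets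
`insert u R` are disconnected. -/
theorem DenseThird.not_all_separated (hG : G.DenseThird δ) {R : Finset V} (hR : R.card + 3 = k)
    (P : V → V → Prop)
    (hP : ∀ u, u ∉ R → ∀ v w, insert v (insert w (insert u R)) ∈ G.edges → (P u v ↔ P u w))
    (h1 : ∀ u, u ∉ R → ∃ v, v ∉ insert u R ∧ P u v)
    (h2 : ∀ u, u ∉ R → ∃ v, v ∉ insert u R ∧ ¬ P u v) : False := by
  set W : Finset V := Finset.univ \ R with hW
  have memW : ∀ u, u ∈ W ↔ u ∉ R := by simp [hW]
  have hWcard : W.card + R.card = Fintype.card V := by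
    rw [hW, Finset.card_sdiff_add_card_eq_card (Finset.subset_univ _), Finset.card_univ]
  -- Double counting of triples outside `R`. Triples that complete `R` to an edge are not separated
  -- at all; any other triple is separated at no more than two vertices, because two of the sets
  -- formed by `R` and a pair from the triple have a common neighbour. Yet each single `u` separates
  -- many pairs, since both sides of `P u` have at least `δ` vertices.
  let I : V → V → V → ℕ := fun u v t => if v ≠ u ∧ t ≠ u ∧ P u v ∧ ¬ P u t then 1 else 0
  let K : V → V → V → ℕ := fun u v t =>
    if u ≠ v ∧ t ≠ u ∧ t ≠ v ∧ insert t (insert v (insert u R)) ∉ G.edges then 1 else 0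
  have hcard1 : ∀ u, u ∉ R → (insert u R).card + 2 = k := fun u hu => by
    rw [Finset.card_insert_of_notMem hu]; omega
  -- each triple is separated at no more than two of its vertices
  have hpt : ∀ u ∈ W, ∀ v ∈ W, ∀ t ∈ W,
      (I u v t + I u t v) + (I v u t + I v t u) + (I t u v + I t v u) ≤ 2 * K u v t := by
    intro u hu v hv t ht
    rw [memW] at hu hv ht
    by_cases huv : u = v
    · subst huv; simp only [I]; grind
    by_cases hut : t = u
    · subst hut; simp only [I]; grind
    by_cases hvt : t = v
    · subst hvt; simp only [I]; grind
    have m : ∀ a b c, a ∉ R → b ∉ R → a ≠ b → b ≠ c → a ≠ c → c ∉ R →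
        G.Meet (insert b (insert a R)) (insert c (insert a R)) → (P a b ↔ P a c) := by
      rintro a b c ha hb hab hbc hac hc ⟨y, hy, hy'⟩
      have := hP a ha y b hy
      have := hP a ha y c hy'
      tauto
    have c : ∀ a b, a ∉ R → b ∉ R → a ≠ b → (insert a (insert b R)).card + 1 = k := by
      intro a b ha hb hab
      rw [Finset.card_insert_of_notMem (by simp [hab, ha]), Finset.card_insert_of_notMem hb]
      omega
    have htri : (P u v ↔ P u t) ∨ (P v u ↔ P v t) ∨ (P t u ↔ P t v) := by
      rcases hG.meet (c v u hv hu (Ne.symm huv)) (c t u ht hu hut) (c t v ht hv hvt) with h | h | h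
      · exact Or.inl (m u v t hu hv huv (Ne.symm hvt) (Ne.symm hut) ht h)
      · refine Or.inr (Or.inl (m v u t hv hu (Ne.symm huv) (Ne.symm hut) (Ne.symm hvt) ht ?_))
        rwa [Finset.insert_comm v u] at h
      · refine Or.inr (Or.inr (m t u v ht hu hut huv hvt hv ?_))
        rwa [Finset.insert_comm t u, Finset.insert_comm t v] at h
    by_cases hE : insert t (insert v (insert u R)) ∈ G.edges
    · have a1 := hP u hu t v hE
      have a2 := hP v hv t u (by rwa [Finset.insert_comm u v])
      have a3 := hP t ht v u (by rwa [Finset.insert_comm u t, Finset.insert_comm v t])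
      simp only [I]; grind
    · simp only [I, K]
      grind
  -- upper bound for the number of non-edges
  have hK : ∀ u ∈ W, ∀ v ∈ W, u ≠ v → ∑ t ∈ W, K u v t + 2 + δ ≤ W.card := by
    intro u hu v hv huv
    rw [memW] at hu hv
    have hsum : ∑ t ∈ W, K u v t =
        (W.filter fun t => u ≠ v ∧ t ≠ u ∧ t ≠ v ∧
          insert t (insert v (insert u R)) ∉ G.edges).card := by
      rw [Finset.card_filter]
    have hd := hG.deg (insert v (insert u R)) (by
      rw [Finset.card_insert_of_notMem (by simp [Ne.symm huv, hv]),
        Finset.card_insert_of_notMem hu]; omega)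
    have hdisj : Disjoint (W.filter fun t => u ≠ v ∧ t ≠ u ∧ t ≠ v ∧
          insert t (insert v (insert u R)) ∉ G.edges) (G.nbr (insert v (insert u R))) := by
      rw [Finset.disjoint_left]
      intro t ht ht'
      exact (Finset.mem_filter.1 ht).2.2.2.2 (mem_nbr.1 ht')
    have hdisj2 : Disjoint ((W.filter fun t => u ≠ v ∧ t ≠ u ∧ t ≠ v ∧
          insert t (insert v (insert u R)) ∉ G.edges) ∪ (G.nbr (insert v (insert u R))))
          {u, v} := by
      rw [Finset.disjoint_left]
      intro t ht ht'
      simp only [Finset.mem_insert, Finset.mem_singleton] at ht'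
      rcases Finset.mem_union.1 ht with h | h
      · have := (Finset.mem_filter.1 h).2
        tauto
      · have := distinct_of_insert_three hR (mem_nbr.1 h)
        tauto
    have hsub : ((W.filter fun t => u ≠ v ∧ t ≠ u ∧ t ≠ v ∧
          insert t (insert v (insert u R)) ∉ G.edges) ∪ (G.nbr (insert v (insert u R)))) ∪
          {u, v} ⊆ W := by
      intro t ht
      rcases Finset.mem_union.1 ht with h | h
      · rcases Finset.mem_union.1 h with h | h
        · exact (Finset.mem_filter.1 h).1
        · rw [memW]
          exact (distinct_of_insert_three hR (mem_nbr.1 h)).2.2.2.1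
      · simp only [Finset.mem_insert, Finset.mem_singleton] at h
        rcases h with rfl | rfl <;> rwa [memW]
    have hle := Finset.card_le_card hsub
    rw [Finset.card_union_of_disjoint hdisj2, Finset.card_union_of_disjoint hdisj,
      Finset.card_pair huv] at hle
    omega
  -- lower bound for the number of separated pairs
  have hI : ∀ u ∈ W, ∃ a b : ℕ, δ ≤ a ∧ δ ≤ b ∧ a + b + 1 = W.card ∧
      ∑ v ∈ W, ∑ t ∈ W, I u v t = a * b := by
    intro u hu
    have hu' := (memW u).1 hu
    have hdeg : ∀ v, v ∉ insert u R → ∀ w ∈ G.nbr (insert v (insert u R)),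
        w ∈ W.erase u ∧ (P u w ↔ P u v) := by
      intro v hv w hw
      have hw' := mem_nbr.1 hw
      have := distinct_of_insert_two (hcard1 u hu') hw'
      refine ⟨?_, hP u hu' _ _ hw'⟩
      simp only [Finset.mem_insert, not_or] at this
      rw [Finset.mem_erase, memW]
      tauto
    have hc1 : ∀ v, v ∉ insert u R → (insert v (insert u R)).card + 1 = k := by
      intro v hv
      rw [Finset.card_insert_of_notMem hv]
      have := hcard1 u hu'
      omega
    refine ⟨((W.erase u).filter fun v => P u v).card, ((W.erase u).filter fun v => ¬ P u v).card,
      ?_, ?_, ?_, ?_⟩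
    · obtain ⟨v, hv, hPv⟩ := h1 u hu'
      refine (hG.deg _ (hc1 v hv)).trans (Finset.card_le_card fun w hw => ?_)
      have := hdeg v hv w hw
      rw [Finset.mem_filter]
      tauto
    · obtain ⟨v, hv, hPv⟩ := h2 u hu'
      refine (hG.deg _ (hc1 v hv)).trans (Finset.card_le_card fun w hw => ?_)
      have := hdeg v hv w hw
      rw [Finset.mem_filter]
      tauto
    · rw [Finset.card_filter_add_card_filter_not, Finset.card_erase_add_one hu]
    · rw [Finset.card_filter, Finset.card_filter, Finset.sum_mul_sum]
      rw [← Finset.add_sum_erase W _ hu]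
      have z1 : ∑ t ∈ W, I u u t = 0 := Finset.sum_eq_zero fun t _ => by simp [I]
      rw [z1, zero_add]
      refine Finset.sum_congr rfl fun v hv => ?_
      rw [← Finset.add_sum_erase W _ hu]
      have z2 : I u v u = 0 := by simp [I]
      rw [z2, zero_add]
      refine Finset.sum_congr rfl fun t ht => ?_
      have := Finset.ne_of_mem_erase hv
      have := Finset.ne_of_mem_erase ht
      simp only [I]
      grind
  set S := ∑ u ∈ W, ∑ v ∈ W, ∑ t ∈ W, I u v t with hS
  have s1 : ∑ u ∈ W, ∑ v ∈ W, ∑ t ∈ W, I u t v = S :=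
    Finset.sum_congr rfl fun u _ => Finset.sum_comm
  have s2 : ∑ u ∈ W, ∑ v ∈ W, ∑ t ∈ W, I v u t = S := Finset.sum_comm
  have s3 : ∑ u ∈ W, ∑ v ∈ W, ∑ t ∈ W, I v t u = S := by
    rw [Finset.sum_comm]; exact s1
  have s4 : ∑ u ∈ W, ∑ v ∈ W, ∑ t ∈ W, I t u v = S := by
    rw [← s2]; exact Finset.sum_congr rfl fun u _ => Finset.sum_comm
  have s5 : ∑ u ∈ W, ∑ v ∈ W, ∑ t ∈ W, I t v u = S := by
    rw [← s3]; exact Finset.sum_congr rfl fun u _ => Finset.sum_comm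
  have hle : 6 * S ≤ 2 * ∑ u ∈ W, ∑ v ∈ W, ∑ t ∈ W, K u v t := by
    have : ∑ u ∈ W, ∑ v ∈ W, ∑ t ∈ W,
        ((I u v t + I u t v) + (I v u t + I v t u) + (I t u v + I t v u)) ≤
        ∑ u ∈ W, ∑ v ∈ W, ∑ t ∈ W, 2 * K u v t :=
      Finset.sum_le_sum fun u hu => Finset.sum_le_sum fun v hv => Finset.sum_le_sum fun t ht =>
        hpt u hu v hv t ht
    simp only [Finset.sum_add_distrib, ← Finset.mul_sum, s1, s2, s3, s4, s5, ← hS] at this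
    omega
  have hlt := hG.card_lt
  have h2δ := hG.two_le
  have hWpos : 0 < W.card := by
    have := hG.le_card
    omega
  obtain ⟨u0, hu0⟩ := Finset.card_pos.1 hWpos
  obtain ⟨a0, b0, ha0, hb0, hab0, -⟩ := hI u0 hu0
  obtain ⟨m, hm⟩ : ∃ m, W.card = m + 1 := ⟨W.card - 1, by omega⟩
  have hKS : ∀ u ∈ W, ∑ v ∈ W, ∑ t ∈ W, K u v t ≤ m * (m - 1 - δ) := by
    intro u hu
    rw [← Finset.add_sum_erase W _ hu]
    have z1 : ∑ t ∈ W, K u u t = 0 := Finset.sum_eq_zero fun t _ => by simp [K]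
    rw [z1, zero_add]
    refine (Finset.sum_le_card_nsmul _ _ (m - 1 - δ) fun v hv => ?_).trans ?_
    · have := hK u hu v (Finset.mem_of_mem_erase hv) (Finset.ne_of_mem_erase hv).symm
      omega
    · rw [Finset.card_erase_of_mem hu, hm, smul_eq_mul]
      simp
  have hIS : ∀ u ∈ W, δ * (m - δ) ≤ ∑ v ∈ W, ∑ t ∈ W, I u v t := by
    intro u hu
    obtain ⟨a, b, ha, hb, hab, h⟩ := hI u hu
    rw [h]
    obtain ⟨a', rfl⟩ := Nat.exists_eq_add_of_le ha
    obtain ⟨b', rfl⟩ := Nat.exists_eq_add_of_le hb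
    have : m - δ = δ + a' + b' := by omega
    rw [this]
    nlinarith [Nat.zero_le (a' * b')]
  have t1 := Finset.card_nsmul_le_sum W _ _ hIS
  have t2 := Finset.sum_le_card_nsmul W _ _ hKS
  rw [smul_eq_mul] at t1 t2
  have t3 : 6 * (W.card * (δ * (m - δ))) ≤ 2 * (W.card * (m * (m - 1 - δ))) :=
    (Nat.mul_le_mul_left 6 t1).trans (hle.trans (Nat.mul_le_mul_left 2 t2))
  have t4 : 3 * (δ * (m - δ)) ≤ m * (m - 1 - δ) := by
    have : W.card * (6 * (δ * (m - δ))) ≤ W.card * (2 * (m * (m - 1 - δ))) := by linarith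
    have := Nat.le_of_mul_le_mul_left this hWpos
    omega
  -- The inequality becomes 3δ(c + 1) ≤ (δ + c + 1)c, while c + 1 < 2δ bounds the right side by 3δc.
  obtain ⟨c, hc⟩ : ∃ c, m = δ + 1 + c := ⟨m - δ - 1, by omega⟩
  have e1 : m - δ = 1 + c := by omega
  have e2 : m - 1 - δ = c := by omega
  rw [e1, e2, hc] at t4
  have : c + 1 < 2 * δ := by omega
  nlinarith

/-- Otherwise all the sets `insert u R` have disconnected link graphs, which the count of triples
rules out. -/
theorem Splitting.exists_mem (hX : G.Splitting X) (hG : G.DenseThird δ) {R : Finset V}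
    (hR : R.card + 3 = k) : ∃ u, u ∉ R ∧ X (insert u R) := by
  by_contra! h
  have hs : ∀ u, u ∉ R → (insert u R).card + 2 = k := fun u hu => by
    rw [Finset.card_insert_of_notMem hu]; omega
  have : ∀ u, ∃ P : V → Prop, u ∉ R →
      (∀ v w, insert v (insert w (insert u R)) ∈ G.edges → (P v ↔ P w)) ∧
      (∃ v, v ∉ insert u R ∧ P v) ∧ ∃ v, v ∉ insert u R ∧ ¬ P v := by
    intro u
    by_cases hu : u ∈ R
    · exact ⟨fun _ => True, fun h => absurd hu h⟩
    · obtain ⟨P, hP⟩ := hX.exists_separation hG (hs u hu) (h u hu)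
      exact ⟨P, fun _ => hP⟩
  choose P hP using this
  exact hG.not_all_separated hR P (fun u hu => (hP u hu).1) (fun u hu => (hP u hu).2.1)
    fun u hu => (hP u hu).2.2

end Parity
end KGraph

namespace KGraph

/-! ### Sizes of the classes of a splitting. -/

section Classes

variable {V : Type*} [Fintype V] [DecidableEq V] {k : ℕ}
variable {G : KGraph V k} {δ : ℕ} {X : Finset V → Prop}

open Classical in
/-- The class of `x` in the partition of the edge `e` given by a splitting. -/
noncomputable def sepClass (X : Finset V → Prop) (e : Finset V) (x : V) : Finset V :=
  e.filter fun u => u = x ∨ ¬ X (e \ {x, u})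

theorem mem_sepClass {e : Finset V} {x u : V} :
    u ∈ sepClass X e x ↔ u ∈ e ∧ (u = x ∨ ¬ X (e \ {x, u})) := by
  simp [sepClass]

/-- How the class of `x` changes when the two vertices `v`, `v'` of another class are
replaced with the vertices `y`, `z`. -/
theorem Splitting.replace_pair (hX : G.Splitting X) (hG : G.DenseThird δ) {Q : Finset V}
    {r x v v' y z : V} (hQ : (insert r Q).card + 3 = k) (hr : r ∉ Q)
    (he : insert v (insert v' (insert x (insert r Q))) ∈ G.edges)
    (he' : insert z (insert y (insert x (insert r Q))) ∈ G.edges)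
    (hx : ¬ X (insert x (insert r Q))) (hv : X (insert v (insert r Q)))
    (hy : ¬ X (insert y (insert r Q))) :
    X (insert v (insert v' Q)) ↔ X (insert z (insert y Q)) := by
  have d := distinct_of_insert_three hQ he
  have d' := distinct_of_insert_three hQ he'
  have hcr : (insert r Q).card = Q.card + 1 := Finset.card_insert_of_notMem hr
  simp only [Finset.mem_insert, not_or] at d d'
  obtain ⟨-, hvx, -, ⟨hvr, hvQ⟩, -, hxr, hxQ⟩ := d
  obtain ⟨-, -, hyx, -, ⟨hyr, hyQ⟩, -⟩ := d'
  have hR2 : (insert x Q).card + 3 = k := by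
    rw [Finset.card_insert_of_notMem hxQ]; omega
  have hcomm : insert r (insert x Q) = insert x (insert r Q) := Finset.insert_comm _ _ _
  have hx2 : ¬ X (insert r (insert x Q)) := by rwa [hcomm]
  have hT : (insert x (insert r Q)).card + 2 = k := by
    rw [Finset.card_insert_of_notMem (by simp [hxr, hxQ])]; omega
  have hP := fun u w (h : insert u (insert w (insert x (insert r Q))) ∈ G.edges) =>
    hX.link_iff hQ hx h
  have hP' := fun u w (h : insert u (insert w (insert x (insert r Q))) ∈ G.edges) =>
    hX.link_iff (x := r) (v := u) (w := w) hR2 hx2 (by rwa [hcomm])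
  obtain ⟨u, huR, hu⟩ := hX.exists_mem hG hR2
  have hur : u ≠ r := by rintro rfl; exact hx2 hu
  obtain ⟨w, hwr, hwR, hw⟩ := hX.exists_not hG hR2 hx2
    (by simp [Ne.symm hxr, hr]) huR hu
  simp only [Finset.mem_insert, not_or] at huR hwR
  have p1 := hX.even (insert v Q) r x v'
    (by rw [Finset.card_insert_of_notMem hvQ]; omega)
    (by convert he using 1; ext; simp only [Finset.mem_insert]; clear * -; tauto)
  have p2 := hX.even (insert y Q) r x z
    (by rw [Finset.card_insert_of_notMem hyQ]; omega)
    (by convert he' using 1; ext; simp only [Finset.mem_insert]; clear * -; tauto)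
  rw [Finset.insert_comm r v, Finset.insert_comm x v, Finset.insert_comm v' v] at p1
  rw [Finset.insert_comm r y, Finset.insert_comm x y] at p2
  -- In the link graph of `{x, r} ∪ Q` the two invariants take at most two joint values. The first
  -- one differs at `v` and `y` and the second one is not constant, so the second one differs at `v`
  -- and `y` too. Evenness in the two edges turns this into the claim.
  have key : ∀ t, t ∉ insert x (insert r Q) →
      ¬ (X (insert t (insert x Q)) ↔ X (insert v (insert x Q))) →
      ¬ (X (insert v (insert x Q)) ↔ X (insert y (insert x Q))) := by
    intro t ht hne hvy
    have h3 := hG.two_values hT hP hP' (a := v) (b := y) (c := t)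
      (by simp [hvx, hvr, hvQ]) (by simp [hyx, hyr, hyQ]) ht
    clear * - h3 hne hvy hv hy
    grind
  have hne : ¬ (X (insert v (insert x Q)) ↔ X (insert y (insert x Q))) := by
    by_cases h : X (insert v (insert x Q))
    · exact key w (by simp [hwR, hwr]) (by simp [h, hw])
    · exact key u (by simp [huR, hur]) (by simp [h, hu])
  clear * - hne p1 p2 hv hy
  grind

-- Two vertices `v`, `v'` outside the class of `x` are replaced: `y` comes from
-- `Splitting.exists_not`, and `z` is any vertex that completes the edge. Both join the class of
-- `x`, and by `Splitting.replace_pair` all other vertices keep their position relative to `x`.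
set_option maxHeartbeats 1000000 in
theorem Splitting.exists_class_add_two (hX : G.Splitting X) (hG : G.DenseThird δ) {e : Finset V}
    (he : e ∈ G.edges) {x : V} (hx : x ∈ e) (hc : (sepClass X e x).card + 2 ≤ k) :
    ∃ e' ∈ G.edges, x ∈ e' ∧ (sepClass X e' x).card = (sepClass X e x).card + 2 := by
  have hek := G.card_eq e he
  have hsub : sepClass X e x ⊆ e := fun u hu => (mem_sepClass.1 hu).1
  have h2 : 1 < (e \ sepClass X e x).card := by
    rw [Finset.card_sdiff_of_subset hsub]; omega
  obtain ⟨v, hv, v', hv', hvv'⟩ := Finset.one_lt_card.1 h2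
  simp only [Finset.mem_sdiff, mem_sepClass, not_and, not_or, not_not] at hv hv'
  obtain ⟨hve, hv⟩ := hv
  obtain ⟨hve', hv'⟩ := hv'
  obtain ⟨hvx, hXv⟩ := hv hve
  obtain ⟨hvx', hXv'⟩ := hv' hve'
  obtain ⟨R, rfl, hxR, hvR, hvR'⟩ : ∃ R, e = insert v (insert v' (insert x R)) ∧
      x ∉ R ∧ v ∉ R ∧ v' ∉ R := by
    refine ⟨e \ {v, v', x}, ?_, by simp, by simp, by simp⟩
    ext u
    simp only [Finset.mem_insert, Finset.mem_sdiff, Finset.mem_singleton]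
    grind
  have hR : R.card + 3 = k := by
    rw [Finset.card_insert_of_notMem (by simp [hvv', hvx, hvR]),
      Finset.card_insert_of_notMem (by simp [hvx', hvR']), Finset.card_insert_of_notMem hxR] at hek
    exact hek
  have e1 : insert v (insert v' (insert x R)) \ {x, v} = insert v' R := by
    ext u; simp only [Finset.mem_insert, Finset.mem_sdiff, Finset.mem_singleton]; grind
  have e2 : insert v (insert v' (insert x R)) \ {x, v'} = insert v R := by
    ext u; simp only [Finset.mem_insert, Finset.mem_sdiff, Finset.mem_singleton]; grind
  rw [e1] at hXv
  rw [e2] at hXv'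
  have hXx : ¬ X (insert x R) := by
    have := hX.even R v v' x hR he
    tauto
  obtain ⟨y, hyx, hyR, hy⟩ := hX.exists_not hG hR hXx hxR hvR hXv'
  obtain ⟨z, hz⟩ := hG.exists_nbr (S := insert y (insert x R))
    (by rw [Finset.card_insert_of_notMem (by simp [hyx, hyR]), Finset.card_insert_of_notMem hxR]
        omega)
  have hXz : ¬ X (insert z R) := by
    rwa [hX.link_iff hR hXx hz]
  obtain ⟨hzy, hzx, -, hzR, -, -⟩ := distinct_of_insert_three hR hz
  refine ⟨_, hz, by simp, ?_⟩
  have hcls : sepClass X (insert z (insert y (insert x R))) x =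
      insert z (insert y (sepClass X (insert v (insert v' (insert x R))) x)) := by
    ext u
    simp only [Finset.mem_insert, mem_sepClass]
    by_cases huz : u = z
    · subst huz
      have : insert u (insert y (insert x R)) \ {x, u} = insert y R := by
        ext t; simp only [Finset.mem_insert, Finset.mem_sdiff, Finset.mem_singleton]; grind
      rw [this]; tauto
    by_cases huy : u = y
    · subst huy
      have : insert z (insert u (insert x R)) \ {x, u} = insert z R := by
        ext t; simp only [Finset.mem_insert, Finset.mem_sdiff, Finset.mem_singleton]; grind
      rw [this]; tauto
    by_cases hux : u = x
    · simp [hux]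
    by_cases huv : u = v
    · subst huv
      rw [e1]; tauto
    by_cases huv' : u = v'
    · subst huv'
      rw [e2]; tauto
    by_cases huR : u ∈ R
    · have hQ : insert u (R.erase u) = R := Finset.insert_erase huR
      have := hX.replace_pair hG (Q := R.erase u) (r := u) (x := x) (v := v) (v' := v') (y := y)
        (z := z) (by rwa [hQ]) (by simp) (by rwa [hQ]) (by rwa [hQ]) (by rwa [hQ])
        (by rwa [hQ]) (by rwa [hQ])
      have e3 : insert v (insert v' (insert x R)) \ {x, u} = insert v (insert v' (R.erase u)) := by
        ext t; simp only [Finset.mem_insert, Finset.mem_sdiff, Finset.mem_singleton,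
          Finset.mem_erase]; grind
      have e4 : insert z (insert y (insert x R)) \ {x, u} = insert z (insert y (R.erase u)) := by
        ext t; simp only [Finset.mem_insert, Finset.mem_sdiff, Finset.mem_singleton,
          Finset.mem_erase]; grind
      rw [e3, e4]
      grind
    · grind
  have hyc : y ∉ sepClass X (insert v (insert v' (insert x R))) x := by
    intro h
    obtain ⟨h1, h2⟩ := mem_sepClass.1 h
    simp only [Finset.mem_insert] at h1
    rcases h1 with rfl | rfl | h | h
    · exact hy hXv'
    · exact hy hXv
    · exact hyx h
    · exact hyR h
  have hzc : z ∉ sepClass X (insert v (insert v' (insert x R))) x := by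
    intro h
    obtain ⟨h1, h2⟩ := mem_sepClass.1 h
    simp only [Finset.mem_insert] at h1
    rcases h1 with rfl | rfl | h | h
    · exact hXz hXv'
    · exact hXz hXv
    · exact hzx h
    · exact hzR h
  rw [hcls, Finset.card_insert_of_notMem (by simp [hzy, hzc]), Finset.card_insert_of_notMem hyc]

/-- By evenness, a third vertex is separated from exactly one of two separated vertices, so their
classes are complementary. -/
theorem Splitting.exists_class_compl (hX : G.Splitting X) {e : Finset V}
    (he : e ∈ G.edges) {x : V} (hx : x ∈ e) :
    ∃ u ∈ e, (sepClass X e u).card + (sepClass X e x).card = k := by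
  obtain ⟨s, hs, hsx, hXs⟩ := hX.exists_separated he hx
  refine ⟨s, hs, ?_⟩
  have hsub : sepClass X e x ⊆ e := fun u hu => (mem_sepClass.1 hu).1
  have : sepClass X e s = e \ sepClass X e x := by
    ext u
    simp only [Finset.mem_sdiff, mem_sepClass]
    by_cases hu : u ∈ e
    swap
    · tauto
    by_cases hux : u = x
    · subst hux
      rw [Finset.pair_comm] at hXs
      tauto
    by_cases hus : u = s
    · subst hus; tauto
    have := hX.even_sdiff he hx hs hu (Ne.symm hsx) (Ne.symm hux) (Ne.symm hus)
    tauto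
  rw [this, Finset.card_sdiff_add_card_eq_card hsub, G.card_eq e he]

/-- The possible class sizes. -/
def IsClassSize (G : KGraph V k) (X : Finset V → Prop) (c : ℕ) : Prop :=
  ∃ e ∈ G.edges, ∃ x ∈ e, (sepClass X e x).card = c

theorem Splitting.isClassSize_pos {c : ℕ} (h : G.IsClassSize X c) : 0 < c := by
  obtain ⟨e, -, x, hx, rfl⟩ := h
  exact Finset.card_pos.2 ⟨x, mem_sepClass.2 ⟨hx, Or.inl rfl⟩⟩

theorem Splitting.isClassSize_compl (hX : G.Splitting X) {c : ℕ} (h : G.IsClassSize X c) :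
    ∃ c', G.IsClassSize X c' ∧ c' + c = k := by
  obtain ⟨e, he, x, hx, rfl⟩ := h
  obtain ⟨u, hu, h⟩ := hX.exists_class_compl he hx
  exact ⟨_, ⟨e, he, u, hu, rfl⟩, h⟩

theorem Splitting.isClassSize_add (hX : G.Splitting X) (hG : G.DenseThird δ) {c : ℕ}
    (h : G.IsClassSize X c) (j : ℕ) (hj : c + 2 * j ≤ k) : G.IsClassSize X (c + 2 * j) := by
  induction j with
  | zero => simpa using h
  | succ j ih =>
    obtain ⟨e, he, x, hx, hc⟩ := ih (by omega)
    obtain ⟨e', he', hx', hc'⟩ := hX.exists_class_add_two hG he hx (by omega)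
    exact ⟨e', he', x, hx', by omega⟩

/-- Every odd number below `k` is a class size. -/
theorem Splitting.isClassSize_odd (hX : G.Splitting X) (hG : G.DenseThird δ) {d : ℕ}
    (hd : Odd d) (hdk : d ∣ k) : G.IsClassSize X d := by
  have hno : ¬ G.IsClassSize X k := by
    intro h
    obtain ⟨c, h1, h2⟩ := hX.isClassSize_compl h
    have := isClassSize_pos h1
    omega
  -- A class whose size has the parity of `k` would grow by twos until it filled an edge.
  have hpar : ∀ c, G.IsClassSize X c → c % 2 ≠ k % 2 := by
    intro c hc hmod
    obtain ⟨c', h1, h2⟩ := hX.isClassSize_compl hc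
    have h := hX.isClassSize_add hG hc ((k - c) / 2) (by omega)
    rw [show c + 2 * ((k - c) / 2) = k by omega] at h
    exact hno h
  obtain ⟨S, -, hS⟩ := Finset.exists_subset_card_eq (s := (Finset.univ : Finset V)) (n := k - 1)
    (by rw [Finset.card_univ]; have := hG.le_card; omega)
  have h3 := hG.three_le
  obtain ⟨y, hy⟩ := hG.exists_nbr (S := S) (by omega)
  obtain ⟨c, hc⟩ : ∃ c, G.IsClassSize X c := ⟨_, _, hy, y, by simp, rfl⟩
  obtain ⟨c', hc', hcc'⟩ := hX.isClassSize_compl hc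
  have p1 := hpar c hc
  have p2 := hpar c' hc'
  have hpos := isClassSize_pos hc
  -- A class of size `k - 1` leaves a class of size 1, which grows by twos to any odd size.
  have hk1 := hX.isClassSize_add hG hc ((k - 1 - c) / 2) (by omega)
  rw [show c + 2 * ((k - 1 - c) / 2) = k - 1 by omega] at hk1
  obtain ⟨c1, h1, h1'⟩ := hX.isClassSize_compl hk1
  obtain rfl : c1 = 1 := by omega
  have hle := Nat.le_of_dvd (by omega) hdk
  obtain ⟨j, rfl⟩ := hd
  have := hX.isClassSize_add hG h1 j (by omega)
  rwa [Nat.add_comm] at this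

end Classes
end KGraph

namespace KGraph

/-! ### Moves between arrangements of edges in slots. -/

section Moves

variable {V ι : Type*} [DecidableEq V] [Fintype ι] [DecidableEq ι] {k : ℕ}

/-- An assignment of vertices to slots whose image is an edge. -/
def IsArrangement (G : KGraph V k) (f : ι → V) : Prop :=
  Finset.univ.image f ∈ G.edges

/-- Two arrangements that differ in at most one slot. -/
def Move (G : KGraph V k) (f g : ι → V) : Prop :=
  G.IsArrangement f ∧ G.IsArrangement g ∧ ∃ i, ∀ j, j ≠ i → f j = g j

/-- `g` is obtained from `f` by `n` moves. -/
def Reach (G : KGraph V k) : ℕ → (ι → V) → (ι → V) → Prop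
  | 0, f, g => f = g
  | n + 1, f, g => ∃ h, G.Move f h ∧ Reach G n h g

variable {G : KGraph V k}

theorem Move.comp {f g : ι → V} (h : G.Move f g) (π : Equiv.Perm ι) : G.Move (f ∘ π) (g ∘ π) := by
  obtain ⟨hf, hg, i, hi⟩ := h
  have key : ∀ f : ι → V, Finset.univ.image (f ∘ π) = Finset.univ.image f := by
    intro f
    rw [← Finset.image_image, Finset.image_univ_equiv]
  refine ⟨by rwa [IsArrangement, key], by rwa [IsArrangement, key], π.symm i, fun j hj => ?_⟩
  exact hi _ fun h => hj (by rw [← h]; simp)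

theorem Reach.comp {n : ℕ} {f g : ι → V} (h : G.Reach n f g) (π : Equiv.Perm ι) :
    G.Reach n (f ∘ π) (g ∘ π) := by
  induction n generalizing f with
  | zero => exact congrArg (· ∘ π) h
  | succ n ih =>
    obtain ⟨h, h1, h2⟩ := h
    exact ⟨h ∘ π, h1.comp π, ih h2⟩

theorem Reach.trans {m n : ℕ} {f g h : ι → V} (h1 : G.Reach m f g) (h2 : G.Reach n g h) :
    G.Reach (m + n) f h := by
  induction m generalizing f with
  | zero => obtain rfl : f = g := h1; rwa [Nat.zero_add]
  | succ m ih =>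
    obtain ⟨f', h3, h4⟩ := h1
    rw [Nat.add_right_comm]
    exact ⟨f', h3, ih h4⟩

theorem Move.reach {f g : ι → V} (h : G.Move f g) : G.Reach 1 f g := ⟨g, h, rfl⟩

theorem reach_self [Nonempty ι] {f : ι → V} (hf : G.IsArrangement f) (n : ℕ) :
    G.Reach n f f := by
  induction n with
  | zero => rfl
  | succ n ih => exact ⟨f, ⟨hf, hf, Classical.arbitrary ι, fun _ _ => rfl⟩, ih⟩

theorem Reach.mono [Nonempty ι] {m n : ℕ} {f g : ι → V} (hf : G.IsArrangement f) (hmn : m ≤ n)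
    (h : G.Reach m f g) : G.Reach n f g := by
  obtain ⟨j, rfl⟩ := Nat.exists_eq_add_of_le hmn
  rw [Nat.add_comm]
  exact (reach_self hf j).trans h

/-- The sequence of arrangements behind a sequence of moves. -/
theorem Reach.exists_seq [Nonempty ι] {n : ℕ} {f g : ι → V} (hf : G.IsArrangement f)
    (h : G.Reach n f g) :
    ∃ p : ℕ → ι → V, p 0 = f ∧ (∀ s, n ≤ s → p s = g) ∧ ∀ s, G.Move (p s) (p (s + 1)) := by
  induction n generalizing f with
  | zero =>
    obtain rfl : f = g := h
    exact ⟨fun _ => f, rfl, fun _ _ => rfl,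
      fun _ => ⟨hf, hf, Classical.arbitrary ι, fun _ _ => rfl⟩⟩
  | succ n ih =>
    obtain ⟨f', h1, h2⟩ := h
    obtain ⟨p, p0, pn, pm⟩ := ih h1.2.1 h2
    refine ⟨fun s => Nat.casesOn s f p, rfl, ?_, ?_⟩
    · rintro (_ | s) hs
      · omega
      · exact pn s (by omega)
    · rintro (_ | s)
      · change G.Move f (p 0)
        rwa [p0]
      · exact pm s

/-- This is (i l) = (i j)(j l)(i j). Moves commute with relabelling the slots, so a reachable
transposition can be applied again after other permutations. -/
theorem reach_swap_conj [Nonempty ι] {m n : ℕ} {f : ι → V} (hf : G.IsArrangement f) {i j l : ι}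
    (h1 : G.Reach m f (f ∘ Equiv.swap i j)) (h2 : G.Reach n f (f ∘ Equiv.swap j l)) :
    G.Reach (2 * m + n) f (f ∘ Equiv.swap i l) := by
  by_cases hil : i = l
  · subst hil
    simpa using reach_self hf _
  by_cases hij : i = j
  · subst hij
    exact h2.mono hf (by omega)
  by_cases hjl : j = l
  · subst hjl
    exact h1.mono hf (by omega)
  have h3 : G.Reach (m + (n + m)) f
      (((f ∘ Equiv.swap i j) ∘ Equiv.swap j l) ∘ Equiv.swap i j) :=
    h1.trans ((h2.trans (h1.comp (Equiv.swap j l))).comp (Equiv.swap i j))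
  have h4 : ((f ∘ Equiv.swap i j) ∘ Equiv.swap j l) ∘ Equiv.swap i j = f ∘ Equiv.swap i l := by
    have := Equiv.swap_mul_swap_mul_swap (x := l) (y := j) (z := i) (Ne.symm hjl) (Ne.symm hil)
    rw [Equiv.swap_comm j i, Equiv.swap_comm l j] at this
    rw [← this]
    rfl
  rw [h4] at h3
  exact h3.mono hf (by omega)

/-- If the transpositions within the classes of an equivalence relation are
reachable, then so are the permutations that preserve the classes. -/
theorem reach_perm [Nonempty ι] {c : ℕ} {f : ι → V} (hf : G.IsArrangement f) {r : ι → ι → Prop}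
    (hr : Equivalence r) (h : ∀ i j, r i j → G.Reach c f (f ∘ Equiv.swap i j))
    (π : Equiv.Perm ι) (hπ : ∀ i, r i (π i)) : G.Reach (c * π.support.card) f (f ∘ π) := by
  induction hn : π.support.card using Nat.strong_induction_on generalizing π with
  | _ n ih =>
    by_cases h1 : ∀ i, π i = i
    · obtain rfl : π = 1 := Equiv.ext h1
      exact reach_self hf _
    push Not at h1
    obtain ⟨i, hi⟩ := h1
    -- Splitting off this transposition fixes the slot `i` and still preserves the classes.
    set ρ := Equiv.swap i (π i) * π with hρ
    have hlt : ρ.support.card < π.support.card := Equiv.Perm.card_support_swap_mul hi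
    have hρr : ∀ j, r j (ρ j) := by
      intro j
      rw [hρ, Equiv.Perm.mul_apply]
      by_cases h2 : π j = i
      · rw [h2, Equiv.swap_apply_left]
        have := hπ j
        rw [h2] at this
        exact hr.trans this (hπ i)
      by_cases h3 : π j = π i
      · rw [h3, Equiv.swap_apply_right]
        rw [π.injective h3]
        exact hr.refl i
      · rw [Equiv.swap_apply_of_ne_of_ne h2 h3]
        exact hπ j
    have h4 := ih _ (by omega) ρ hρr rfl
    have h5 : π = Equiv.swap i (π i) * ρ := by simp [hρ, ← mul_assoc]
    have h6 : G.Reach (c * ρ.support.card + c) f ((f ∘ Equiv.swap i (π i)) ∘ ρ) :=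
      h4.trans ((h i (π i) (hπ i)).comp ρ)
    have h7 : (f ∘ Equiv.swap i (π i)) ∘ ρ = f ∘ π := by
      funext j
      exact congrArg f (congrArg (fun σ : Equiv.Perm ι => σ j) h5).symm
    rw [h7] at h6
    refine h6.mono hf ?_
    rw [← Nat.mul_succ]
    exact Nat.mul_le_mul_left c (by omega)

end Moves

/-! ### Exchanging two vertices of an edge. -/

section Swaps

variable {V : Type*} [DecidableEq V] {k : ℕ} {G : KGraph V k}
variable (ι : Type*) [Fintype ι] [DecidableEq ι]

/-- Every arrangement of `e` on the slots `ι` allows to exchange `u` and `v` in `n` moves. -/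
def Swaps (G : KGraph V k) (n : ℕ) (e : Finset V) (u v : V) : Prop :=
  ∀ f : ι → V, Finset.univ.image f = e → ∀ i j, f i = u → f j = v →
    G.Reach n f (f ∘ Equiv.swap i j)

variable {ι}

theorem injective_of_image {f : ι → V} (hι : Fintype.card ι = k) {e : Finset V}
    (he : e ∈ G.edges) (hf : Finset.univ.image f = e) : Function.Injective f := by
  have : (Finset.univ.image f).card = (Finset.univ : Finset ι).card := by
    rw [hf, G.card_eq e he, Finset.card_univ, hι]
  simpa using Finset.card_image_iff.1 this

theorem Swaps.mono [Nonempty ι] {m n : ℕ} {e : Finset V} (he : e ∈ G.edges) {u v : V}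
    (hmn : m ≤ n) (h : G.Swaps ι m e u v) : G.Swaps ι n e u v := fun f hf i j hi hj =>
  (h f hf i j hi hj).mono (by rwa [IsArrangement, hf]) hmn

theorem Swaps.symm {n : ℕ} {e : Finset V} {u v : V} (h : G.Swaps ι n e u v) :
    G.Swaps ι n e v u := fun f hf i j hi hj => by
  rw [Equiv.swap_comm]
  exact h f hf j i hj hi

theorem Swaps.conj [Nonempty ι] {m n : ℕ} {e : Finset V} (he : e ∈ G.edges) {u v w : V}
    (hv : v ∈ e) (h1 : G.Swaps ι m e u v) (h2 : G.Swaps ι n e v w) :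
    G.Swaps ι (2 * m + n) e u w := by
  intro f hf i l hi hl
  obtain ⟨j, -, hj⟩ := Finset.mem_image.1 (hf.symm ▸ hv : v ∈ Finset.univ.image f)
  exact reach_swap_conj (by rwa [IsArrangement, hf]) (h1 f hf i j hi hj) (h2 f hf j l hj hl)

theorem image_update_eq {f : ι → V} (hf : Function.Injective f) (s : ι) (y : V) :
    Finset.univ.image (Function.update f s y) = insert y ((Finset.univ.image f).erase (f s)) := by
  ext x
  simp only [Finset.mem_image, Finset.mem_univ, true_and, Finset.mem_insert, Finset.mem_erase]
  constructor
  · rintro ⟨a, rfl⟩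
    by_cases h : a = s
    · subst h; simp
    · right
      rw [Function.update_of_ne h]
      exact ⟨fun h' => h (hf h'), a, rfl⟩
  · rintro (rfl | ⟨h1, a, rfl⟩)
    · exact ⟨s, by simp⟩
    · exact ⟨a, Function.update_of_ne (fun h => h1 (by rw [h])) _ _⟩

/-- The common neighbour `y` serves as a placeholder: put `y` in place of `u`, then `u` in place of
`v`, then `v` in place of `y`. -/
theorem swaps_of_meet [Nonempty ι] (hι : Fintype.card ι = k) {e : Finset V} (he : e ∈ G.edges)
    {u v : V} (h : G.Meet (e.erase u) (e.erase v)) : G.Swaps ι 3 e u v := by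
  intro f hf i j hi hj
  have hinj := injective_of_image hι he hf
  have harr : G.IsArrangement f := by rwa [IsArrangement, hf]
  by_cases hij : i = j
  · subst hij
    simpa using reach_self harr 3
  obtain ⟨y, hy1, hy2⟩ := h
  subst hi hj
  set f1 := Function.update f i y with hf1
  set f2 := Function.update f1 j (f i) with hf2
  have i1 : Finset.univ.image f1 = insert y (e.erase (f i)) := by
    rw [hf1, image_update_eq hinj, hf]
  have a1 : G.IsArrangement f1 := by rwa [IsArrangement, i1]
  have inj1 : Function.Injective f1 := injective_of_image hι a1 rfl
  have hji : j ≠ i := Ne.symm hij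
  have f1j : f1 j = f j := by rw [hf1, Function.update_of_ne hji]
  have hyi : y ∉ e.erase (f i) := by
    refine notMem_of_insert_mem ?_ hy1
    have : f i ∈ e := by rw [← hf]; simp
    have := Finset.card_erase_add_one this
    have := G.card_eq e he
    omega
  have hyj : y ∉ e.erase (f j) := by
    refine notMem_of_insert_mem ?_ hy2
    have : f j ∈ e := by rw [← hf]; simp
    have := Finset.card_erase_add_one this
    have := G.card_eq e he
    omega
  have hine : f i ≠ f j := fun h => hij (hinj h)
  have hje : f j ∈ e := by rw [← hf]; simp
  have hie : f i ∈ e := by rw [← hf]; simp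
  have i2 : Finset.univ.image f2 = insert y (e.erase (f j)) := by
    rw [hf2, image_update_eq inj1, i1, f1j]
    ext x
    simp only [Finset.mem_insert, Finset.mem_erase] at hyi hyj ⊢
    grind
  have a2 : G.IsArrangement f2 := by rwa [IsArrangement, i2]
  have hlast : ∀ l, l ≠ i → f2 l = (f ∘ Equiv.swap i j) l := by
    intro l hl
    rw [Function.comp_apply]
    by_cases hlj : l = j
    · subst hlj; simp [hf2]
    · rw [Equiv.swap_apply_of_ne_of_ne hl hlj, hf2, Function.update_of_ne hlj, hf1,
        Function.update_of_ne hl]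
  have a3 : G.IsArrangement (f ∘ Equiv.swap i j) := by
    rw [IsArrangement, ← Finset.image_image, Finset.image_univ_equiv]
    exact harr
  refine ⟨f1, ⟨harr, a1, i, fun l hl => ?_⟩, f2, ⟨a1, a2, j, fun l hl => ?_⟩, _,
    ⟨a2, a3, i, hlast⟩, rfl⟩
  · rw [hf1, Function.update_of_ne hl]
  · rw [hf2, Function.update_of_ne hl]

/-- One move trades `y` for `y'`, and after the exchange one more trades back; hence `n + 2`. -/
theorem Swaps.transport (hι : Fintype.card ι = k) {n : ℕ} {S : Finset V}
    {u y y' : V} (hy : insert y S ∈ G.edges) (hy' : insert y' S ∈ G.edges) (hyS : y ∉ S)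
    (hu : u ∈ S)
    (h : G.Swaps ι n (insert y' S) u y') : G.Swaps ι (n + 2) (insert y S) u y := by
  intro f hf i s hi hs
  have hinj := injective_of_image hι hy hf
  have harr : G.IsArrangement f := by rwa [IsArrangement, hf]
  set g := Function.update f s y' with hg
  have ig : Finset.univ.image g = insert y' S := by
    rw [hg, image_update_eq hinj, hf, hs, Finset.erase_insert hyS]
  have ag : G.IsArrangement g := by rwa [IsArrangement, ig]
  have his : i ≠ s := by
    rintro rfl
    rw [hi] at hs
    exact hyS (hs ▸ hu)
  have m1 : G.Move f g := ⟨harr, ag, s, fun l hl => by rw [hg, Function.update_of_ne hl]⟩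
  have m2 : G.Move g f := ⟨ag, harr, s, fun l hl => by rw [hg, Function.update_of_ne hl]⟩
  have h1 := h g ig i s (by rw [hg, Function.update_of_ne his, hi]) (by simp [hg])
  have := (m1.reach.trans h1).trans (m2.comp (Equiv.swap i s)).reach
  rwa [show 1 + n + 1 = n + 2 by omega] at this

end Swaps

/-! ### Without flexible edges, linked pairs form a splitting. -/

section Flexible

variable {V : Type*} [DecidableEq V] [Fintype V] {k : ℕ} {G : KGraph V k} {δ : ℕ}
variable (ι : Type*) [Fintype ι] [DecidableEq ι]

/-- Any two vertices of `e` can be exchanged in at most `20` moves. -/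
def Flexible (G : KGraph V k) (e : Finset V) : Prop :=
  ∀ u ∈ e, ∀ v ∈ e, G.Swaps ι 20 e u v

/-- Two vertices of `e` that can be exchanged by way of a common neighbour. -/
def Linked (G : KGraph V k) (e : Finset V) (u v : V) : Prop :=
  G.Meet (e.erase u) (e.erase v)

variable {ι}

theorem DenseThird.linked_three (hG : G.DenseThird δ) {e : Finset V} (he : e ∈ G.edges) {u v w : V}
    (hu : u ∈ e) (hv : v ∈ e) (hw : w ∈ e) :
    G.Linked e u v ∨ G.Linked e u w ∨ G.Linked e v w := by
  have := G.card_eq e he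
  exact hG.meet (by rw [Finset.card_erase_add_one hu, this])
    (by rw [Finset.card_erase_add_one hv, this]) (by rw [Finset.card_erase_add_one hw, this])

theorem linked_self {e : Finset V} (he : e ∈ G.edges) {u : V} (hu : u ∈ e) : G.Linked e u u :=
  ⟨u, by rwa [Finset.insert_erase hu], by rwa [Finset.insert_erase hu]⟩

/-- If `u`, `w` are not linked, every vertex of `e` is linked to one of them. With the path through
`v`, any two vertices are then joined by at most three links, and conjugation along three links
costs 2·3 + (2·3 + 3) = 15 moves. So a failure of transitivity would make `e` flexible. -/
theorem DenseThird.linked_trans [Nonempty ι] (hι : Fintype.card ι = k) (hG : G.DenseThird δ)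
    {e : Finset V} (he : e ∈ G.edges) (hf : ¬ G.Flexible ι e) {u v w : V}
    (hu : u ∈ e) (hv : v ∈ e) (hw : w ∈ e) (huv : G.Linked e u v) (hvw : G.Linked e v w) :
    G.Linked e u w := by
  by_contra huw
  apply hf
  have hs : ∀ {a b}, G.Linked e a b → G.Swaps ι 3 e a b := fun h => swaps_of_meet hι he h
  have path : ∀ {p a b q}, a ∈ e → b ∈ e → G.Linked e p a → G.Linked e a b → G.Linked e b q →
      G.Swaps ι 20 e p q := by
    intro p a b q ha hb h1 h2 h3
    exact ((hs h1).conj he ha ((hs h2).conj he hb (hs h3))).mono he (by norm_num)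
  intro p hp q hq
  by_cases hpq : G.Linked e p q
  · exact (hs hpq).mono he (by norm_num)
  have h1 := hG.linked_three he hp hu hw
  have h2 := hG.linked_three he hq hu hw
  have h3 := hG.linked_three he hv hp hq
  rcases h1 with h1 | h1 | h1
  · rcases h2 with h2 | h2 | h2
    · exact path hu hu h1 (linked_self he hu) h2.symm
    · rcases h3 with h3 | h3 | h3
      · exact path hv hw h3.symm hvw h2.symm
      · exact path hu hv h1 huv h3
      · exact absurd h3 hpq
    · exact absurd h2 huw
  · rcases h2 with h2 | h2 | h2
    · rcases h3 with h3 | h3 | h3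
      · exact path hv hu h3.symm huv.symm h2.symm
      · exact path hw hv h1 hvw.symm h3
      · exact absurd h3 hpq
    · exact path hw hw h1 (linked_self he hw) h2.symm
    · exact absurd h2 huw
  · exact absurd h1 huw

theorem exists_not_linked [Nonempty ι] (hι : Fintype.card ι = k) {e : Finset V} (he : e ∈ G.edges)
    (hf : ¬ G.Flexible ι e) : ∃ u ∈ e, ∃ v ∈ e, ¬ G.Linked e u v := by
  by_contra! h
  exact hf fun u hu v hv => (swaps_of_meet hι he (h u hu v hv)).mono he (by norm_num)

theorem linked_insert {T : Finset V} {u v : V} (hT : T.card + 2 = k)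
    (h : insert u (insert v T) ∈ G.edges) :
    G.Linked (insert u (insert v T)) u v ↔ G.Meet (insert u T) (insert v T) := by
  obtain ⟨h1, h2, h3⟩ := distinct_of_insert_two hT h
  rw [Linked, Finset.erase_insert (by simp [h1, h2]), Finset.insert_comm,
    Finset.erase_insert (by simp [Ne.symm h1, h3])]
  exact ⟨Meet.symm, Meet.symm⟩

/-- Passing through the first edge, `u` and `v'` can be exchanged in 5 moves even if they are not
linked. But if they are not linked, each vertex of the second edge is linked to one of them, and a
conjugation at both ends costs at most 2·3 + (2·3 + 5) = 17 moves: that edge would be flexible. -/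
theorem DenseThird.meet_transport [Nonempty ι] (hι : Fintype.card ι = k) (hG : G.DenseThird δ)
    (hf : ∀ e ∈ G.edges, ¬ G.Flexible ι e) {T : Finset V} (hT : T.card + 2 = k) {u v v' : V}
    (h : insert u (insert v T) ∈ G.edges) (h' : insert u (insert v' T) ∈ G.edges)
    (hm : G.Meet (insert u T) (insert v T)) : G.Meet (insert u T) (insert v' T) := by
  by_contra hm'
  rw [← linked_insert hT h] at hm
  rw [← linked_insert hT h'] at hm'
  apply hf _ h'
  have s1 := swaps_of_meet (ι := ι) hι h hm
  have d := distinct_of_insert_two hT h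
  have d' := distinct_of_insert_two hT h'
  have s2 : G.Swaps ι 5 (insert u (insert v' T)) u v' := by
    have h1 := h
    have h1' := h'
    rw [Finset.insert_comm] at s1 h1 h1' ⊢
    exact s1.transport hι h1' h1 (by simp [Ne.symm d'.1, d'.2.2]) (by simp)
  set e := insert u (insert v' T) with he
  have hue : u ∈ e := by simp [he]
  have hve : v' ∈ e := by simp [he]
  have hs : ∀ {a b}, G.Linked e a b → G.Swaps ι 3 e a b := fun h => swaps_of_meet hι h' h
  have path : ∀ {p q}, G.Linked e p u → G.Linked e q v' → G.Swaps ι 20 e p q := by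
    intro p q hp hq
    exact (((hs hq).conj h' hve ((hs hp).conj h' hue s2).symm).mono h' (by norm_num)).symm
  intro p hp q hq
  by_cases hpq : G.Linked e p q
  · exact (hs hpq).mono h' (by norm_num)
  rcases hG.linked_three h' hp hue hve with h1 | h1 | h1
  · rcases hG.linked_three h' hq hue hve with h2 | h2 | h2
    · exact absurd (hG.linked_trans hι h' (hf e h') hp hue hq h1 h2.symm) hpq
    · exact path h1 h2
    · exact absurd h2 hm'
  · rcases hG.linked_three h' hq hue hve with h2 | h2 | h2
    · exact (path h2 h1).symm
    · exact absurd (hG.linked_trans hι h' (hf e h') hp hve hq h1 h2.symm) hpq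
    · exact absurd h2 hm'
  · exact absurd h1 hm'

/-- The sets whose link graph has an edge without common neighbours. -/
def Cross (G : KGraph V k) (T : Finset V) : Prop :=
  ∃ u v, insert u (insert v T) ∈ G.edges ∧ ¬ G.Meet (insert u T) (insert v T)

/-- All edges in the link graph of `T` behave alike: linkedness passes between edges that share a
vertex, and among the ends of one edge and an end of another, two have a common neighbour, which
connects the edges or settles the matter at once. -/
theorem DenseThird.cross_iff [Nonempty ι] (hι : Fintype.card ι = k) (hG : G.DenseThird δ)
    (hf : ∀ e ∈ G.edges, ¬ G.Flexible ι e) {T : Finset V} (hT : T.card + 2 = k) {u w : V}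
    (h : insert w (insert u T) ∈ G.edges) :
    G.Cross T ↔ ¬ G.Meet (insert w T) (insert u T) := by
  refine ⟨?_, fun h1 => ⟨w, u, h, h1⟩⟩
  rintro ⟨v, v', hvv', hm⟩ hwu
  have key : ∀ v v', insert v (insert v' T) ∈ G.edges → G.Meet (insert v T) (insert w T) →
      G.Meet (insert v T) (insert v' T) := by
    rintro v v' hvv' ⟨x, hx1, hx2⟩
    have hx1' := hx1
    have hx2' := hx2
    rw [Finset.insert_comm] at hx1' hx2'
    have m1 := hG.meet_transport hι hf hT h hx2' hwu
    have m2 := hG.meet_transport hι hf hT hx2 hx1 m1.symm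
    exact hG.meet_transport hι hf hT hx1' hvv' m2.symm
  have hc : ∀ {a}, a ∉ T → (insert a T).card + 1 = k := fun ha => by
    rw [Finset.card_insert_of_notMem ha]; omega
  have d1 := distinct_of_insert_two hT h
  have d2 := distinct_of_insert_two hT hvv'
  rcases hG.meet (hc d2.2.1) (hc d2.2.2) (hc d1.2.1) with h1 | h1 | h1
  · exact hm h1
  · exact hm (key v v' hvv' h1)
  · exact hm (key v' v (by rwa [Finset.insert_comm]) h1).symm

/-- Linkedness is an equivalence on each edge, with at most two classes by `linked_three` and more
than one by `exists_not_linked`; `cross_iff` reads it off from the other `k - 2` vertices. -/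
theorem DenseThird.splitting_cross [Nonempty ι] (hι : Fintype.card ι = k) (hG : G.DenseThird δ)
    (hf : ∀ e ∈ G.edges, ¬ G.Flexible ι e) : G.Splitting G.Cross where
  even R u v w hR h := by
    obtain ⟨h1, h2, h3, h4, h5, h6⟩ := distinct_of_insert_three hR h
    have hc : ∀ {a}, a ∉ R → (insert a R).card + 2 = k := fun ha => by
      rw [Finset.card_insert_of_notMem ha]; omega
    set e := insert u (insert v (insert w R)) with he
    have eu : e = insert v (insert w (insert u R)) := by
      rw [he]; ext; simp only [Finset.mem_insert]; clear * -; tauto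
    have ev : e = insert u (insert w (insert v R)) := by
      rw [he]; ext; simp only [Finset.mem_insert]; clear * -; tauto
    have cu := hG.cross_iff hι hf (hc h4) (w := v) (u := w) (by rwa [← eu])
    have cv := hG.cross_iff hι hf (hc h5) (w := u) (u := w) (by rwa [← ev])
    have cw := hG.cross_iff hι hf (hc h6) (w := u) (u := v) h
    rw [← linked_insert (hc h4) (by rwa [← eu]), ← eu] at cu
    rw [← linked_insert (hc h5) (by rwa [← ev]), ← ev] at cv
    rw [← linked_insert (hc h6) h, ← he] at cw
    have hue : u ∈ e := by simp [he]
    have hve : v ∈ e := by simp [he]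
    have hwe : w ∈ e := by simp [he]
    have t3 := hG.linked_three h hue hve hwe
    have q1 := hG.linked_trans hι h (hf e h) hue hve hwe
    have q2 := hG.linked_trans hι h (hf e h) hue hwe hve
    have q3 := hG.linked_trans hι h (hf e h) hve hue hwe
    have y1 : G.Linked e u v ↔ G.Linked e v u := ⟨Meet.symm, Meet.symm⟩
    have y2 : G.Linked e w v ↔ G.Linked e v w := ⟨Meet.symm, Meet.symm⟩
    rw [cu, cv, cw]
    clear * - t3 q1 q2 q3 y1 y2
    grind
  proper e he := by
    obtain ⟨u, hu, v, hv, huv⟩ := exists_not_linked hι he (hf e he)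
    have hne : u ≠ v := by
      rintro rfl
      exact huv (linked_self he hu)
    have hT : ((e.erase u).erase v).card + 2 = k := by
      have h1 := Finset.card_erase_add_one (Finset.mem_erase.2 ⟨Ne.symm hne, hv⟩)
      have h2 := Finset.card_erase_add_one hu
      have := G.card_eq e he
      omega
    have hins : e = insert u (insert v ((e.erase u).erase v)) := by
      rw [Finset.insert_erase (Finset.mem_erase.2 ⟨Ne.symm hne, hv⟩), Finset.insert_erase hu]
    refine ⟨(e.erase u).erase v, u, v, hT, hins, ?_⟩
    rw [hG.cross_iff hι hf hT (w := u) (u := v) (by rwa [← hins]),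
      ← linked_insert hT (by rwa [← hins]), ← hins]
    exact huv

end Flexible
end KGraph

namespace KGraph

/-! ### From moves to closed tight walks. -/

section ClosedWalks

variable {V : Type*} [DecidableEq V] {k : ℕ} {G : KGraph V k}

/-- A closed tight walk of length `ℓ`: a homomorphic image of the tight cycle. -/
def IsClosedWalk (G : KGraph V k) (ℓ : ℕ) (w : ZMod ℓ → V) : Prop :=
  ∀ i : ZMod ℓ, (Finset.range k).image (fun j : ℕ => w (i + (j : ZMod ℓ))) ∈ G.edges

/-- A window reads the slots below `q % k` from the arrangement of the next round and the others
from the current one. As these differ in one slot only, the window shows one of the two entirely. -/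
theorem window_mem_edges [NeZero k] {p : ℕ → ZMod k → V} (hp : ∀ s, G.Move (p s) (p (s + 1)))
    (q : ℕ) :
    (Finset.range k).image (fun j : ℕ => p ((q + j) / k) ((q + j : ℕ) : ZMod k)) ∈ G.edges := by
  have hk : 0 < k := NeZero.pos k
  obtain ⟨h1, h2, i, hi⟩ := hp (q / k)
  have hq : k * (q / k) + q % k = q := Nat.div_add_mod q k
  have hr : q % k < k := Nat.mod_lt q hk
  set s := q / k with hs
  have lo : ∀ j, q % k + j < k →
      (q + j) / k = s ∧ ((q + j : ℕ) : ZMod k).val = q % k + j := by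
    intro j hj
    have e : q + j = q % k + j + k * s := by omega
    constructor
    · rw [e, Nat.add_mul_div_left _ _ hk, Nat.div_eq_of_lt hj, zero_add]
    · rw [ZMod.val_natCast, e, Nat.add_mul_mod_self_left, Nat.mod_eq_of_lt hj]
  have hi' : ∀ j, j < k → k ≤ q % k + j →
      (q + j) / k = s + 1 ∧ ((q + j : ℕ) : ZMod k).val = q % k + j - k := by
    intro j hjk hj
    have e : q + j = (q % k + j - k) + k * (s + 1) := by rw [Nat.mul_succ]; omega
    constructor
    · rw [e, Nat.add_mul_div_left _ _ hk, Nat.div_eq_of_lt (by omega), zero_add]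
    · rw [ZMod.val_natCast, e, Nat.add_mul_mod_self_left, Nat.mod_eq_of_lt (by omega)]
  have key : ∀ F : ZMod k → V, G.IsArrangement F →
      (∀ j, j < k → p ((q + j) / k) ((q + j : ℕ) : ZMod k) = F ((q + j : ℕ) : ZMod k)) →
      (Finset.range k).image (fun j : ℕ => p ((q + j) / k) ((q + j : ℕ) : ZMod k)) ∈ G.edges := by
    intro F hF h
    rw [IsArrangement] at hF
    convert hF using 1
    ext x
    simp only [Finset.mem_image, Finset.mem_range, Finset.mem_univ, true_and]
    constructor
    · rintro ⟨j, hj, rfl⟩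
      exact ⟨_, (h j hj).symm⟩
    · rintro ⟨a, rfl⟩
      refine ⟨(a - (q : ZMod k)).val, ZMod.val_lt _, ?_⟩
      rw [h _ (ZMod.val_lt _)]
      simp
  by_cases hiq : i.val < q % k
  · refine key _ h2 fun j hj => ?_
    by_cases hj' : q % k + j < k
    · obtain ⟨e1, e2⟩ := lo j hj'
      rw [e1]
      refine hi _ fun h => ?_
      rw [← h, e2] at hiq
      omega
    · rw [(hi' j hj (by omega)).1]
  · refine key _ h1 fun j hj => ?_
    by_cases hj' : q % k + j < k
    · rw [(lo j hj').1]
    · obtain ⟨e1, e2⟩ := hi' j hj (by omega)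
      rw [e1]
      refine (hi _ fun h => ?_).symm
      rw [← h, e2] at hiq
      omega

/-- Position `q` shows slot `q mod k` in round `q / k`. From round `ℓ / k` on the arrangement is `f`
rotated by `ℓ`, so position `m + ℓ` shows `f m` again. -/
theorem exists_closedWalk_of_reach [NeZero k] {ℓ : ℕ} (hℓ : k ≤ ℓ) {f : ZMod k → V}
    (hf : G.IsArrangement f)
    (h : G.Reach (ℓ / k) f (f ∘ (Equiv.subRight (ℓ : ZMod k)))) :
    ∃ w, G.IsClosedWalk ℓ w := by
  have hk : 0 < k := NeZero.pos k
  have : NeZero ℓ := ⟨by omega⟩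
  obtain ⟨p, p0, pn, pm⟩ := h.exists_seq hf
  refine ⟨fun i => p (i.val / k) (i.val : ZMod k), fun i => ?_⟩
  convert window_mem_edges pm i.val using 1
  refine Finset.image_congr fun j hj => ?_
  have hj : j < k := by simpa using hj
  have hi := ZMod.val_lt i
  have hval : (i + (j : ZMod ℓ)).val = (i.val + j) % ℓ := by
    rw [ZMod.val_add, ZMod.val_natCast, Nat.add_mod_mod]
  change p ((i + (j : ZMod ℓ)).val / k) (((i + (j : ZMod ℓ)).val : ℕ) : ZMod k) = _
  rw [hval]
  by_cases hlt : i.val + j < ℓ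
  · rw [Nat.mod_eq_of_lt hlt]
  · obtain ⟨m, hm⟩ : ∃ m, i.val + j = m + ℓ := ⟨i.val + j - ℓ, by omega⟩
    rw [hm, Nat.add_mod_right, Nat.mod_eq_of_lt (by omega), Nat.div_eq_of_lt (by omega), p0,
      pn _ (Nat.div_le_div_right (by omega))]
    simp

/-- The rotation moves at most `k` slots, so `20 * k` moves suffice, and `20 * k ^ 2 ≤ ℓ` provides
that many rounds. -/
theorem exists_closedWalk_of_swaps [NeZero k] {ℓ : ℕ} (hℓ : 20 * k ^ 2 ≤ ℓ) {f : ZMod k → V}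
    (hf : G.IsArrangement f) {r : ZMod k → ZMod k → Prop} (hr : Equivalence r)
    (h : ∀ i j, r i j → G.Reach 20 f (f ∘ Equiv.swap i j))
    (hπ : ∀ i, r i (i - (ℓ : ZMod k))) : ∃ w, G.IsClosedWalk ℓ w := by
  have hk : 0 < k := NeZero.pos k
  have h1 := reach_perm hf hr h (Equiv.subRight (ℓ : ZMod k)) hπ
  refine exists_closedWalk_of_reach (by nlinarith) hf (h1.mono hf ?_)
  have h2 : (Equiv.Perm.support (Equiv.subRight (ℓ : ZMod k))).card ≤ k := by
    refine (Finset.card_le_univ _).trans ?_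
    rw [ZMod.card]
  rw [Nat.le_div_iff_mul_le hk]
  calc 20 * _ * k ≤ 20 * k * k := by gcongr
    _ ≤ ℓ := by rw [mul_assoc, ← sq]; exact hℓ

theorem exists_arrangement [NeZero k] {e A : Finset V} (he : e ∈ G.edges) (hA : A ⊆ e)
    {J : Finset (ZMod k)} (hJ : J.card = A.card) :
    ∃ f : ZMod k → V, Finset.univ.image f = e ∧ ∀ i, i ∈ J ↔ f i ∈ A := by
  have hek := G.card_eq e he
  obtain ⟨φ⟩ : Nonempty (J ≃ A) := ⟨Fintype.equivOfCardEq (by simpa using hJ)⟩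
  obtain ⟨ψ⟩ : Nonempty ((Jᶜ : Finset (ZMod k)) ≃ (e \ A : Finset V)) :=
    ⟨Fintype.equivOfCardEq (by
      rw [Fintype.card_coe, Fintype.card_coe, Finset.card_compl, ZMod.card,
        Finset.card_sdiff_of_subset hA, hJ, hek])⟩
  refine ⟨fun i => if h : i ∈ J then φ ⟨i, h⟩ else ψ ⟨i, by simpa using h⟩, ?_, fun i => ?_⟩
  · ext x
    simp only [Finset.mem_image, Finset.mem_univ, true_and]
    constructor
    · rintro ⟨i, rfl⟩
      by_cases h : i ∈ J
      · simp only [h, dif_pos]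
        exact hA (φ ⟨i, h⟩).2
      · simp only [h, dif_neg, not_false_iff]
        exact (Finset.mem_sdiff.1 (ψ ⟨i, by simpa using h⟩).2).1
    · intro hx
      by_cases hxA : x ∈ A
      · refine ⟨(φ.symm ⟨x, hxA⟩ : J), ?_⟩
        simp
      · have hx' : x ∈ e \ A := Finset.mem_sdiff.2 ⟨hx, hxA⟩
        refine ⟨(ψ.symm ⟨x, hx'⟩ : (Jᶜ : Finset (ZMod k))), ?_⟩
        have := (ψ.symm ⟨x, hx'⟩).2
        rw [Finset.mem_compl] at this
        simp [this]
  · by_cases h : i ∈ J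
    · simp [h]
    · simp only [h, dif_neg, not_false_iff, false_iff]
      exact (Finset.mem_sdiff.1 (ψ ⟨i, by simpa using h⟩).2).2

theorem exists_closedWalk_of_flexible [NeZero k] {ℓ : ℕ} (hℓ : 20 * k ^ 2 ≤ ℓ) {e : Finset V}
    (he : e ∈ G.edges) (hf : G.Flexible (ZMod k) e) : ∃ w, G.IsClosedWalk ℓ w := by
  obtain ⟨f, hfe, -⟩ := exists_arrangement he (Finset.empty_subset e)
    (J := (∅ : Finset (ZMod k))) rfl
  have hm : ∀ i, f i ∈ e := fun i => by rw [← hfe]; simp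
  exact exists_closedWalk_of_swaps hℓ (f := f) (by rwa [IsArrangement, hfe])
    (r := fun _ _ => True) ⟨fun _ => trivial, fun _ => trivial, fun _ _ => trivial⟩
    (fun i j _ => hf _ (hm i) _ (hm j) f hfe i j rfl rfl) fun _ => trivial

theorem card_castHom_eq_zero [NeZero k] {g : ℕ} (hg : g ∣ k) :
    (Finset.univ.filter fun i : ZMod k => ZMod.castHom hg (ZMod g) i = 0).card = k / g := by
  have hk : 0 < k := NeZero.pos k
  have hg0 : 0 < g := Nat.pos_of_dvd_of_pos hg hk
  have : NeZero g := ⟨hg0.ne'⟩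
  have himg : (Finset.univ.filter fun i : ZMod k => ZMod.castHom hg (ZMod g) i = 0) =
      (Finset.range (k / g)).image fun j : ℕ => ((g * j : ℕ) : ZMod k) := by
    ext i
    simp only [Finset.mem_filter, Finset.mem_univ, true_and, Finset.mem_image, Finset.mem_range]
    constructor
    · intro h
      have h1 : ((i.val : ℕ) : ZMod g) = 0 := by
        rw [← h, ZMod.castHom_apply, ZMod.natCast_val]
      obtain ⟨j, hj⟩ := (ZMod.natCast_eq_zero_iff _ _).1 h1
      refine ⟨j, ?_, ?_⟩
      · rw [Nat.lt_div_iff_mul_lt' hg, ← hj]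
        exact ZMod.val_lt i
      · rw [← hj]; simp
    · rintro ⟨j, -, rfl⟩
      rw [map_natCast, ZMod.natCast_eq_zero_iff]
      exact dvd_mul_right g j
  rw [himg, Finset.card_image_of_injOn, Finset.card_range]
  intro a ha b hb hab
  simp only [Finset.coe_range, Set.mem_Iio] at ha hb
  rw [Nat.lt_div_iff_mul_lt' hg] at ha hb
  have := (ZMod.natCast_eq_natCast_iff' _ _ _).1 hab
  rw [Nat.mod_eq_of_lt ha, Nat.mod_eq_of_lt hb] at this
  exact Nat.eq_of_mul_eq_mul_left hg0 this

variable [Fintype V] {δ : ℕ}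

theorem DenseThird.exists_closedWalk (hG : G.DenseThird δ) {ℓ : ℕ} (hℓ : 20 * k ^ 2 ≤ ℓ)
    (hd : Odd (k / Nat.gcd k ℓ)) : ∃ w, G.IsClosedWalk ℓ w := by
  have h3 := hG.three_le
  have : NeZero k := ⟨by omega⟩
  by_cases hf : ∀ e ∈ G.edges, ¬ G.Flexible (ZMod k) e
  swap
  · push Not at hf
    obtain ⟨e, he, hf⟩ := hf
    exact exists_closedWalk_of_flexible hℓ he hf
  have hι : Fintype.card (ZMod k) = k := ZMod.card k
  have hX := hG.splitting_cross hι hf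
  have hg : Nat.gcd k ℓ ∣ k := Nat.gcd_dvd_left k ℓ
  obtain ⟨e, he, x, hx, hc⟩ := hX.isClassSize_odd hG hd (Nat.div_dvd_of_dvd hg)
  have hcls : ∀ u, u ∈ sepClass G.Cross e x ↔ u ∈ e ∧ G.Linked e x u := by
    intro u
    rw [mem_sepClass]
    refine and_congr_right fun hu => ?_
    by_cases hux : u = x
    · subst hux
      simp [linked_self he hu]
    have hins : e = insert x (insert u (e \ {x, u})) := by
      ext t; simp only [Finset.mem_insert, Finset.mem_sdiff, Finset.mem_singleton]; grind
    have hT : (e \ {x, u}).card + 2 = k := by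
      have hs : {x, u} ⊆ e := by
        intro t ht
        simp only [Finset.mem_insert, Finset.mem_singleton] at ht
        rcases ht with rfl | rfl <;> assumption
      have := Finset.card_sdiff_add_card_eq_card hs
      rw [Finset.card_pair (Ne.symm hux), G.card_eq e he] at this
      exact this
    rw [hG.cross_iff hι hf hT (w := x) (u := u) (by rwa [← hins]),
      ← linked_insert hT (by rwa [← hins]), ← hins]
    simp [hux]
  set g := Nat.gcd k ℓ with hgdef
  -- The class of `x` fills the `k / g` slots divisible by `g`. Subtracting `ℓ` preserves them, so
  -- the rotation permutes vertices only within the two classes.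
  obtain ⟨f, hfe, hfJ⟩ := exists_arrangement he (A := sepClass G.Cross e x)
    (fun u hu => ((hcls u).1 hu).1)
    (J := Finset.univ.filter fun i : ZMod k => ZMod.castHom hg (ZMod g) i = 0)
    (by rw [card_castHom_eq_zero hg, hc])
  have hm : ∀ i, f i ∈ e := fun i => by rw [← hfe]; simp
  refine exists_closedWalk_of_swaps hℓ (f := f) (by rwa [IsArrangement, hfe])
    (r := fun i j => ZMod.castHom hg (ZMod g) i = 0 ↔ ZMod.castHom hg (ZMod g) j = 0)
    ⟨fun _ => Iff.rfl, Iff.symm, Iff.trans⟩ (fun i j hij => ?_) fun i => ?_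
  · have hi := hfJ i
    have hj := hfJ j
    simp only [Finset.mem_filter, Finset.mem_univ, true_and, hcls, hm] at hi hj
    have hl : G.Linked e (f i) (f j) := by
      have t := @DenseThird.linked_trans _ _ _ _ _ _ _ _ _ _ hι hG e he (hf e he)
      by_cases hxi : G.Linked e x (f i)
      · have hxj : G.Linked e x (f j) := by tauto
        exact t (hm i) hx (hm j) hxi.symm hxj
      · have hxj : ¬ G.Linked e x (f j) := by tauto
        have := hG.linked_three he hx (hm i) (hm j)
        tauto
    exact (swaps_of_meet hι he hl f hfe i j rfl rfl).mono (by rwa [IsArrangement, hfe])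
      (by norm_num)
  · have : ZMod.castHom hg (ZMod g) (ℓ : ZMod k) = 0 := by
      rw [map_natCast, ZMod.natCast_eq_zero_iff]
      exact Nat.gcd_dvd_right k ℓ
    rw [map_sub, this, sub_zero]

/-- Any two neighbourhoods meet, so all pairs in an edge are linked and every edge is flexible. -/
theorem exists_closedWalk_of_half (hk : 2 ≤ k) (hkV : k ≤ Fintype.card V)
    (hdeg : ∀ S : Finset V, S.card + 1 = k → δ ≤ (G.nbr S).card)
    (hδ : Fintype.card V < 2 * δ) {ℓ : ℕ} (hℓ : 20 * k ^ 2 ≤ ℓ) :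
    ∃ w, G.IsClosedWalk ℓ w := by
  have : NeZero k := ⟨by omega⟩
  obtain ⟨S, -, hS⟩ := Finset.exists_subset_card_eq (s := (Finset.univ : Finset V)) (n := k - 1)
    (by rw [Finset.card_univ]; omega)
  obtain ⟨y, hy⟩ := Finset.card_pos.1 (lt_of_lt_of_le (by omega) (hdeg S (by omega)))
  rw [mem_nbr] at hy
  refine exists_closedWalk_of_flexible hℓ hy fun u hu v hv => ?_
  have hc := G.card_eq _ hy
  refine (swaps_of_meet (ZMod.card k) hy ?_).mono hy (by norm_num)
  by_contra hcon
  have hd : Disjoint (G.nbr ((insert y S).erase u)) (G.nbr ((insert y S).erase v)) := by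
    rw [Finset.disjoint_left]
    intro z hz hz'
    exact hcon ⟨z, mem_nbr.1 hz, mem_nbr.1 hz'⟩
  have h1 := hdeg ((insert y S).erase u) (by rw [Finset.card_erase_add_one hu, hc])
  have h2 := hdeg ((insert y S).erase v) (by rw [Finset.card_erase_add_one hv, hc])
  have h4 := Finset.card_le_univ (G.nbr ((insert y S).erase u) ∪ G.nbr ((insert y S).erase v))
  rw [Finset.card_union_of_disjoint hd] at h4
  omega

end ClosedWalks
end KGraph

/-! ### Boxes in dense families of tuples. -/

section Counting

theorem average_pow_le {α : Type*} [Fintype α] [Nonempty α] {f : α → ℝ} (hf : ∀ a, 0 ≤ f a)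
    (n : ℕ) : ((∑ a, f a) / Fintype.card α) ^ n ≤ (∑ a, f a ^ n) / Fintype.card α := by
  have hc : (0 : ℝ) < Fintype.card α := by exact_mod_cast Fintype.card_pos
  cases n with
  | zero => simp
  | succ n =>
    have := pow_sum_div_card_le_sum_pow (s := Finset.univ) (f := f) (fun a _ => hf a) n
    rw [Finset.card_univ] at this
    rw [div_pow, pow_succ (Fintype.card α : ℝ) n, ← div_div]
    gcongr

theorem sum_fin_succ_fun {α : Type*} [Fintype α] {m : ℕ} (F : (Fin (m + 1) → α) → ℝ) :
    ∑ x, F x = ∑ a : α, ∑ x : Fin m → α, F (Fin.cons a x) := by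
  rw [← (Fin.consEquiv (fun _ : Fin (m + 1) => α)).sum_comp, Fintype.sum_prod_type]
  rfl

theorem prod_fin_succ_fun {α : Type*} [Fintype α] {m : ℕ} (F : (Fin (m + 1) → α) → ℝ) :
    ∏ x, F x = ∏ x : Fin m → α, ∏ a : α, F (Fin.cons a x) := by
  rw [← (Fin.consEquiv (fun _ : Fin (m + 1) => α)).prod_comp, Fintype.prod_prod_type,
    Finset.prod_comm]
  rfl

/-- Density of boxes: replacing each coordinate by a family of coordinates
indexed by `τ` changes a density `η` to a density of at least `η ^ (t ^ m)`. -/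
theorem average_box_ge {V τ : Type*} [Fintype V] [Nonempty V] [Fintype τ] [DecidableEq τ] (m : ℕ)
    (h : (Fin m → V) → ℝ) (h0 : ∀ x, 0 ≤ h x) :
    ((∑ x, h x) / (Fintype.card V : ℝ) ^ m) ^ (Fintype.card τ ^ m) ≤
      (∑ y : Fin m → τ → V, ∏ c : Fin m → τ, h fun i => y i (c i)) /
        (Fintype.card V : ℝ) ^ (Fintype.card τ * m) := by
  set N : ℝ := ((Fintype.card V : ℕ) : ℝ) with hN
  set t := Fintype.card τ with ht
  have hNpos : 0 < N := by rw [hN]; exact_mod_cast Fintype.card_pos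
  induction m with
  | zero =>
    simp only [pow_zero, mul_zero, pow_one, div_one, Finset.univ_unique, Finset.sum_singleton,
      Finset.prod_singleton]
    exact le_of_eq (congrArg h (Subsingleton.elim _ _))
  | succ m ih =>
    -- The first coordinate is multiplied by the power mean inequality over the other ones
    -- (`step3`). For each fixed `a` the induction hypothesis treats `g a`, after a second power
    -- mean inequality, over `a` (`step4`).
    let g : (τ → V) → (Fin m → V) → ℝ := fun a x => ∏ s, h (Fin.cons (a s) x)
    have g0 : ∀ a x, 0 ≤ g a x := fun a x => Finset.prod_nonneg fun s _ => h0 _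
    have cardτV : ((Fintype.card (τ → V) : ℕ) : ℝ) = N ^ t := by
      rw [Fintype.card_fun]; push_cast; rfl
    have cardm : ((Fintype.card (Fin m → V) : ℕ) : ℝ) = N ^ m := by
      rw [Fintype.card_fun]; simp [hN]
    have step1 : ∑ y : Fin (m + 1) → τ → V, ∏ c : Fin (m + 1) → τ, h (fun i => y i (c i)) =
        ∑ a : τ → V, ∑ y : Fin m → τ → V, ∏ c : Fin m → τ, g a fun i => y i (c i) := by
      rw [sum_fin_succ_fun]
      refine Finset.sum_congr rfl fun a _ => Finset.sum_congr rfl fun y _ => ?_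
      rw [prod_fin_succ_fun]
      refine Finset.prod_congr rfl fun c _ => Finset.prod_congr rfl fun s _ => ?_
      congr 1
      funext i
      refine Fin.cases ?_ (fun j => ?_) i <;> simp
    have step2 : ∑ a : τ → V, ∑ x : Fin m → V, g a x =
        ∑ x : Fin m → V, (∑ v, h (Fin.cons v x)) ^ t := by
      rw [Finset.sum_comm]
      refine Finset.sum_congr rfl fun x _ => ?_
      have := Finset.prod_univ_sum (fun _ : τ => (Finset.univ : Finset V))
        (fun _ v => h (Fin.cons v x))
      rw [Fintype.piFinset_univ] at this
      rw [← this, Finset.prod_const, Finset.card_univ]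
    have step3 : ((∑ x, h x) / N ^ (m + 1)) ^ t ≤
        (∑ a : τ → V, ∑ x : Fin m → V, g a x) / N ^ m / N ^ t := by
      rw [step2, sum_fin_succ_fun, Finset.sum_comm]
      have := average_pow_le (α := Fin m → V) (f := fun x => ∑ v, h (Fin.cons v x))
        (fun x => Finset.sum_nonneg fun v _ => h0 _) t
      rw [cardm] at this
      rw [pow_succ, ← div_div, div_pow]
      exact div_le_div_of_nonneg_right this (by positivity)
    have step4 : ((∑ a : τ → V, ∑ x : Fin m → V, g a x) / N ^ m / N ^ t) ^ (t ^ m) ≤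
        (∑ a : τ → V, ((∑ x : Fin m → V, g a x) / N ^ m) ^ (t ^ m)) / N ^ t := by
      have := average_pow_le (α := τ → V) (f := fun a => (∑ x, g a x) / N ^ m)
        (fun a => div_nonneg (Finset.sum_nonneg fun x _ => g0 a x) (by positivity)) (t ^ m)
      rwa [cardτV, ← Finset.sum_div] at this
    calc ((∑ x, h x) / N ^ (m + 1)) ^ (t ^ (m + 1))
        = (((∑ x, h x) / N ^ (m + 1)) ^ t) ^ (t ^ m) := by rw [← pow_mul, pow_succ' t m]
      _ ≤ ((∑ a : τ → V, ∑ x : Fin m → V, g a x) / N ^ m / N ^ t) ^ (t ^ m) :=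
          pow_le_pow_left₀ (pow_nonneg (div_nonneg (Finset.sum_nonneg fun x _ => h0 x)
            (by positivity)) _) step3 _
      _ ≤ _ := step4
      _ ≤ (∑ a : τ → V, (∑ y : Fin m → τ → V, ∏ c : Fin m → τ, g a fun i => y i (c i)) /
            N ^ (t * m)) / N ^ t := by
          gcongr with a
          exact ih (g a) (g0 a)
      _ = _ := by
          rw [step1, ← Finset.sum_div, div_div, ← pow_add, Nat.mul_succ]

open Classical in
/-- Few functions fail to be injective. -/
theorem card_not_injective_le {ι V : Type*} [Fintype ι] [DecidableEq ι] [Fintype V] [Nonempty V] :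
    ((Finset.univ.filter fun x : ι → V => ¬ Function.Injective x).card : ℝ) ≤
      (Fintype.card ι : ℝ) ^ 2 / Fintype.card V * (Fintype.card V : ℝ) ^ Fintype.card ι := by
  set m := Fintype.card ι with hm
  set N := Fintype.card V with hN
  have hNpos : 0 < N := Fintype.card_pos
  have hNr : (0 : ℝ) < N := by exact_mod_cast hNpos
  have hinj : (Finset.univ.filter fun x : ι → V => Function.Injective x).card =
      N.descFactorial m := by
    rw [hm, hN, ← Fintype.card_embedding_eq,
      ← Fintype.card_congr (Equiv.subtypeInjectiveEquivEmbedding ι V), Fintype.card_subtype]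
  have htot := Finset.card_filter_add_card_filter_not (s := (Finset.univ : Finset (ι → V)))
    (fun x => Function.Injective x)
  rw [hinj, Finset.card_univ, Fintype.card_fun] at htot
  have htot' : ((N.descFactorial m : ℕ) : ℝ) +
      ((Finset.univ.filter fun x : ι → V => ¬ Function.Injective x).card : ℝ) = (N : ℝ) ^ m := by
    exact_mod_cast htot
  -- For `N ≤ m` the bound is at least the number of all maps; otherwise it is Bernoulli's
  -- inequality for (1 - m/N)^m.
  by_cases hmN : N ≤ m
  · have h1 : (1 : ℝ) ≤ (m : ℝ) ^ 2 / N := by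
      rw [le_div_iff₀ hNr, one_mul]
      have : (N : ℝ) ≤ m := by exact_mod_cast hmN
      have : (1 : ℝ) ≤ N := by exact_mod_cast hNpos
      nlinarith
    have h2 : (0 : ℝ) ≤ (N.descFactorial m : ℕ) := Nat.cast_nonneg _
    have h3 : (0 : ℝ) ≤ (N : ℝ) ^ m := by positivity
    nlinarith
  · have h1 : ((N - m : ℕ) : ℝ) ^ m ≤ (N.descFactorial m : ℕ) := by
      have := Nat.pow_sub_le_descFactorial N m
      have h2 : (N - m) ^ m ≤ (N + 1 - m) ^ m := Nat.pow_le_pow_left (by omega) m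
      exact_mod_cast h2.trans this
    rw [Nat.cast_sub (by omega)] at h1
    have h2 := one_add_mul_le_pow (a := -((m : ℝ) / N)) (by
      have : (m : ℝ) / N ≤ 1 := by
        rw [div_le_one hNr]; exact_mod_cast (by omega : m ≤ N)
      linarith) m
    have h3 : (N : ℝ) ^ m * (1 + (m : ℝ) * -((m : ℝ) / N)) ≤ ((N : ℝ) - m) ^ m := by
      calc _ ≤ (N : ℝ) ^ m * (1 + -((m : ℝ) / N)) ^ m := by gcongr
        _ = ((N : ℝ) - m) ^ m := by
          rw [← mul_pow]
          congr 1
          field_simp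
          ring
    have h4 : (m : ℝ) ^ 2 / N * (N : ℝ) ^ m = (N : ℝ) ^ m * (m * (m / N)) := by ring
    rw [h4]
    linarith

open Classical in
/-- A dense set of `m`-tuples contains a box with pairwise distinct vertices. -/
theorem exists_injective_box (τ : Type*) [Fintype τ] [DecidableEq τ] (m : ℕ) {η : ℝ} (hη : 0 < η) :
    ∃ n₀ : ℕ, ∀ (V : Type) [Fintype V], n₀ ≤ Fintype.card V → ∀ H : Finset (Fin m → V),
      η * (Fintype.card V : ℝ) ^ m ≤ H.card →
      ∃ y : Fin m → τ → V, Function.Injective (fun p : Fin m × τ => y p.1 p.2) ∧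
        ∀ c : Fin m → τ, (fun i => y i (c i)) ∈ H := by
  set t := Fintype.card τ with ht
  -- Beyond this size the fraction (mt)²/N of families with a repetition is smaller than the
  -- fraction η^(t^m) of boxes.
  obtain ⟨n₀, hn₀⟩ := exists_nat_gt (((m * t : ℕ) : ℝ) ^ 2 / η ^ (t ^ m))
  refine ⟨n₀ + 1, fun V _ hV H hH => ?_⟩
  have hpos : 0 < Fintype.card V := by omega
  have : Nonempty V := Fintype.card_pos_iff.1 hpos
  set N : ℝ := ((Fintype.card V : ℕ) : ℝ) with hN
  have hNr : 0 < N := by rw [hN]; exact_mod_cast hpos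
  let h : (Fin m → V) → ℝ := fun x => if x ∈ H then 1 else 0
  have hsum : ∑ x, h x = H.card := by simp [h]
  have hbox := average_box_ge (τ := τ) m h (fun x => by simp only [h]; split_ifs <;> norm_num)
  rw [hsum, ← hN, ← ht] at hbox
  set B : Finset (Fin m → τ → V) :=
    Finset.univ.filter fun y => ∀ c : Fin m → τ, (fun i => y i (c i)) ∈ H with hB
  have hBsum : ∑ y : Fin m → τ → V, ∏ c : Fin m → τ, h (fun i => y i (c i)) = B.card := by
    rw [hB, Finset.card_filter]
    push_cast
    refine Finset.sum_congr rfl fun y _ => ?_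
    by_cases hy : ∀ c : Fin m → τ, (fun i => y i (c i)) ∈ H
    · rw [if_pos hy]
      exact Finset.prod_eq_one fun c _ => if_pos (hy c)
    · rw [if_neg hy]
      push Not at hy
      obtain ⟨c, hc⟩ := hy
      exact Finset.prod_eq_zero (Finset.mem_univ c) (if_neg hc)
  rw [hBsum, le_div_iff₀ (by positivity)] at hbox
  have hη' : η ≤ H.card / N ^ m := by rwa [le_div_iff₀ (by positivity)]
  have hlow : η ^ (t ^ m) * N ^ (t * m) ≤ B.card :=
    (mul_le_mul_of_nonneg_right (pow_le_pow_left₀ hη.le hη' _) (by positivity)).trans hbox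
  have hbad := card_not_injective_le (ι := Fin m × τ) (V := V)
  rw [Fintype.card_prod, Fintype.card_fin, ← ht, ← hN] at hbad
  by_contra! hcon
  have hle' : (B.card : ℝ) ≤ ((m * t : ℕ) : ℝ) ^ 2 / N * N ^ (m * t) := by
    refine le_trans (Nat.cast_le.2 ?_) hbad
    refine Finset.card_le_card_of_injOn (fun y p => y p.1 p.2) (fun y hy => ?_) ?_
    · have hy' := (Finset.mem_filter.1 hy).2
      refine Finset.mem_filter.2 ⟨Finset.mem_univ _, fun hinj => ?_⟩
      obtain ⟨c, hc⟩ := hcon y hinj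
      exact hc (hy' c)
    · intro y _ y' _ hyy
      funext i s
      exact congrFun hyy (i, s)
  have h1 : η ^ (t ^ m) * N ^ (t * m) ≤ ((m * t : ℕ) : ℝ) ^ 2 / N * N ^ (m * t) := hlow.trans hle'
  rw [Nat.mul_comm t m] at h1
  have h2 := le_of_mul_le_mul_right h1 (by positivity)
  rw [le_div_iff₀ hNr] at h2
  rw [div_lt_iff₀ (by positivity)] at hn₀
  have h3 : (n₀ : ℝ) + 1 ≤ N := by rw [hN]; exact_mod_cast hV
  have h4 : 0 < η ^ (t ^ m) := by positivity
  have h5 : N < n₀ := by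
    refine lt_of_mul_lt_mul_left (a := η ^ (t ^ m)) ?_ h4.le
    rw [mul_comm _ (n₀ : ℝ)]
    exact h2.trans_lt hn₀
  linarith

end Counting

/-! ### An exponential tail bound by counting. -/

section Sampling

open Classical in
-- The sum factorises over `J`, and each factor is |V| - (1 - e^{-s})|A|, which 1 + x ≤ e^x bounds.
theorem sum_exp_hits_le {V J : Type*} [Fintype V] [Nonempty V] [Fintype J] [DecidableEq J]
    (A : Finset V) {p s : ℝ} (hs : 0 ≤ s) (hA : p * Fintype.card V ≤ A.card) :
    ∑ x : J → V, Real.exp (-(s * ((Finset.univ.filter fun j => x j ∈ A).card : ℝ))) ≤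
      (Fintype.card V : ℝ) ^ Fintype.card J *
        Real.exp (-((1 - Real.exp (-s)) * p * Fintype.card J)) := by
  set N : ℝ := ((Fintype.card V : ℕ) : ℝ) with hN
  have h1 : ∀ x : J → V, Real.exp (-(s * ((Finset.univ.filter fun j => x j ∈ A).card : ℝ))) =
      ∏ j, if x j ∈ A then Real.exp (-s) else 1 := by
    intro x
    rw [Finset.prod_ite, Finset.prod_const, Finset.prod_const_one, mul_one, ← Real.exp_nat_mul]
    congr 1
    ring
  have h2 := Finset.prod_univ_sum (fun _ : J => (Finset.univ : Finset V))
    (fun _ v => if v ∈ A then Real.exp (-s) else 1)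
  rw [Fintype.piFinset_univ] at h2
  rw [Finset.sum_congr rfl fun x _ => h1 x, ← h2, Finset.prod_const, Finset.card_univ]
  have h3 : ∑ v : V, (if v ∈ A then Real.exp (-s) else 1) = N - (1 - Real.exp (-s)) * A.card := by
    have h4 := Finset.card_filter_add_card_filter_not (s := (Finset.univ : Finset V))
      (fun v => v ∈ A)
    rw [Finset.sum_ite, Finset.sum_const, Finset.sum_const]
    have h5 : (Finset.univ.filter fun v => v ∈ A) = A := by simp
    rw [h5] at h4 ⊢
    rw [Finset.card_univ] at h4
    have h6 : ((Finset.univ.filter fun v => v ∉ A).card : ℝ) = N - A.card := by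
      rw [hN, ← h4]; push_cast; ring
    rw [nsmul_eq_mul, nsmul_eq_mul, h6]
    ring
  rw [h3, mul_comm ((1 - Real.exp (-s)) * p), Real.exp_neg, ← Real.exp_neg, ← mul_neg,
    Real.exp_nat_mul, ← mul_pow]
  have he : Real.exp (-s) ≤ 1 := Real.exp_le_one_iff.2 (by linarith)
  refine pow_le_pow_left₀ ?_ ?_ _
  · rw [← h3]
    exact Finset.sum_nonneg fun v _ => by split_ifs <;> positivity
  · have h7 := Real.add_one_le_exp (-((1 - Real.exp (-s)) * p))
    have hN0 : 0 ≤ N := by positivity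
    calc N - (1 - Real.exp (-s)) * A.card ≤ N - (1 - Real.exp (-s)) * (p * N) := by
          have : 0 ≤ 1 - Real.exp (-s) := by linarith
          gcongr
      _ = N * (-((1 - Real.exp (-s)) * p) + 1) := by ring
      _ ≤ _ := by gcongr

open Classical in
/-- A Chernoff bound by counting: a random map rarely hits too few elements of a large set
that depends only on the values of the map on `S`. -/
theorem card_few_hits_le {V ι : Type*} [Fintype V] [Nonempty V] [Fintype ι]
    [DecidableEq ι] (S : Finset ι) (A : ({i // i ∈ S} → V) → Finset V)
    (valid : ({i // i ∈ S} → V) → Prop) {p s T : ℝ} (hs : 0 ≤ s)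
    (hA : ∀ a, valid a → p * Fintype.card V ≤ (A a).card) :
    ((Finset.univ.filter fun x : ι → V => valid (fun i => x i) ∧
      ((Finset.univ.filter fun j => x j ∈ A fun i => x i).card : ℝ) ≤ T).card : ℝ) ≤
      (Fintype.card V : ℝ) ^ Fintype.card ι *
        Real.exp (s * T - (1 - Real.exp (-s)) * p * (Fintype.card ι - S.card)) := by
  set N : ℝ := ((Fintype.card V : ℕ) : ℝ) with hN
  -- Exponential Markov inequality with the values on `S` fixed first: the target set is then
  -- determined and the remaining coordinates are independent.
  let F : ({i // i ∈ S} → V) → ({i // i ∉ S} → V) → ℝ := fun a b =>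
    if valid a then Real.exp (s * T) *
      Real.exp (-(s * ((Finset.univ.filter fun j => b j ∈ A a).card : ℝ))) else 0
  have hJ : Fintype.card {i // i ∉ S} = Fintype.card ι - S.card := by
    rw [Fintype.card_subtype_compl, Fintype.card_coe]
  have hSle : S.card ≤ Fintype.card ι := Finset.card_le_univ S
  have h1 : ∀ x : ι → V, (if valid (fun i => x i) ∧
      ((Finset.univ.filter fun j => x j ∈ A fun i => x i).card : ℝ) ≤ T then (1 : ℝ) else 0) ≤
      F (fun i => x i) fun i => x i := by
    intro x
    by_cases hv : valid (fun i => x i)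
    · by_cases hT : ((Finset.univ.filter fun j => x j ∈ A fun i => x i).card : ℝ) ≤ T
      · rw [if_pos ⟨hv, hT⟩]
        simp only [F, if_pos hv]
        rw [← Real.exp_add]
        refine Real.one_le_exp ?_
        have h2 : ((Finset.univ.filter fun j : {i // i ∉ S} => x j ∈ A fun i => x i).card : ℝ) ≤
            ((Finset.univ.filter fun j => x j ∈ A fun i => x i).card : ℝ) := by
          refine Nat.cast_le.2 (Finset.card_le_card_of_injOn (fun j => j.1) (fun j hj => ?_)
            (fun _ _ _ _ h => Subtype.ext h))
          exact Finset.mem_filter.2 ⟨Finset.mem_univ _, (Finset.mem_filter.1 hj).2⟩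
        nlinarith
      · rw [if_neg fun h => hT h.2]
        simp only [F]
        split_ifs; positivity
    · rw [if_neg fun h => hv h.1]
      simp only [F]
      split_ifs; positivity
  have h2 : ((Finset.univ.filter fun x : ι → V => valid (fun i => x i) ∧
      ((Finset.univ.filter fun j => x j ∈ A fun i => x i).card : ℝ) ≤ T).card : ℝ) ≤
      ∑ x : ι → V, F (fun i => x i) fun i => x i := by
    rw [Finset.card_filter]
    push_cast
    exact Finset.sum_le_sum fun x _ => h1 x
  have h3 : ∑ x : ι → V, F (fun i => x i) (fun i => x i) =
      ∑ a : {i // i ∈ S} → V, ∑ b : {i // i ∉ S} → V, F a b := by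
    rw [← Fintype.sum_prod_type']
    exact (Equiv.piEquivPiSubtypeProd (fun i => i ∈ S) fun _ => V).sum_comp fun q => F q.1 q.2
  have h4 : ∀ a, ∑ b, F a b ≤ Real.exp (s * T) * (N ^ (Fintype.card ι - S.card) *
      Real.exp (-((1 - Real.exp (-s)) * p * (Fintype.card ι - S.card : ℕ)))) := by
    intro a
    by_cases hv : valid a
    · simp only [F, if_pos hv, ← Finset.mul_sum]
      have := sum_exp_hits_le (J := {i // i ∉ S}) (A a) hs (hA a hv)
      rw [hJ] at this
      gcongr
    · simp only [F, if_neg hv, Finset.sum_const_zero]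
      positivity
  refine h2.trans (h3.le.trans ((Finset.sum_le_card_nsmul _ _ _ fun a _ => h4 a).trans ?_))
  rw [Finset.card_univ, Fintype.card_fun, Fintype.card_coe, nsmul_eq_mul, Nat.cast_pow, ← hN]
  have h5 : N ^ Fintype.card ι = N ^ S.card * N ^ (Fintype.card ι - S.card) := by
    rw [← pow_add, Nat.add_sub_cancel' hSle]
  rw [h5, sub_eq_add_neg (s * T), Real.exp_add, Nat.cast_sub hSle]
  apply le_of_eq
  ring

end Sampling

namespace KGraph

/-! ### Supersaturation: from closed walks to cycles. -/

section Pullback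

variable {V ι : Type*} [DecidableEq V] [DecidableEq ι] {k : ℕ}

/-- The hypergraph on the index set of a family of vertices induced by `G`. -/
def pullback (G : KGraph V k) (x : ι → V) : KGraph ι k where
  edges := {I | I.card = k ∧ I.image x ∈ G.edges}
  card_eq := fun _ h => h.1

theorem mem_nbr_pullback [Fintype ι] {G : KGraph V k} {x : ι → V} {S : Finset ι}
    (hS : S.card + 1 = k) {j : ι} :
    j ∈ (G.pullback x).nbr S ↔ insert (x j) (S.image x) ∈ G.edges := by
  rw [mem_nbr]
  change (insert j S).card = k ∧ (insert j S).image x ∈ G.edges ↔ _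
  rw [Finset.image_insert]
  refine ⟨fun h => h.2, fun h => ⟨?_, h⟩⟩
  have h1 := G.card_eq _ h
  rw [← Finset.image_insert] at h1
  have h2 := Finset.card_image_le (s := insert j S) (f := x)
  have h3 := Finset.card_insert_le j S
  omega

variable [Fintype V]

open Classical in
/-- Most maps from a large set of indices induce a hypergraph with almost the same relative
minimum codegree. -/
theorem eventually_card_good_ge (k : ℕ) {c ε : ℝ} (hc : 0 ≤ c) (hε : 0 < ε) :
    ∀ᶠ m : ℕ in atTop, ∃ n₀ : ℕ, ∀ (V : Type) [Fintype V] [DecidableEq V],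
      n₀ ≤ Fintype.card V → ∀ G : KGraph V k,
      (∀ S : Finset V, S.card + 1 = k → (c + ε) * Fintype.card V ≤ (G.nbr S).card) →
      (1 / 2) * (Fintype.card V : ℝ) ^ m ≤ ((Finset.univ.filter fun x : Fin m → V =>
        ∀ S : Finset (Fin m), S.card + 1 = k → c * m < ((G.pullback x).nbr S).card).card : ℝ) := by
  -- With `c * s < ε`, the estimate 1 - e^{-s} ≥ s/(1 + s) gives `s * c < u`, so failure at a fixed
  -- `S` is exponentially rare in `m`, which beats the at most m^(k-1) choices of `S`.
  obtain ⟨s, hs, hsc⟩ : ∃ s : ℝ, 0 < s ∧ c * s < ε :=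
    ⟨ε / (c + 1), by positivity, by
      rw [mul_div_assoc', div_lt_iff₀ (by linarith)]; nlinarith⟩
  set u := (1 - Real.exp (-s)) * (c + ε) with hu
  have hu1 : s * c < u := by
    have h1 : Real.exp (-s) ≤ 1 / (1 + s) := by
      rw [Real.exp_neg, ← one_div]
      exact one_div_le_one_div_of_le (by linarith) (by linarith [Real.add_one_le_exp s])
    have h2 : s / (1 + s) ≤ 1 - Real.exp (-s) := by
      have : s / (1 + s) = 1 - 1 / (1 + s) := by field_simp; ring
      linarith
    calc s * c < s / (1 + s) * (c + ε) := by
          rw [div_mul_eq_mul_div, lt_div_iff₀ (by linarith)]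
          nlinarith
      _ ≤ u := by rw [hu]; gcongr
  have hlim : Tendsto (fun m : ℕ => Real.exp (u * (k - 1 : ℕ)) * ((m : ℝ) ^ (k - 1) *
      (Real.exp (-(u - s * c))) ^ m)) atTop (𝓝 0) := by
    have := (tendsto_pow_const_mul_const_pow_of_abs_lt_one (k - 1)
      (r := Real.exp (-(u - s * c))) (by
        rw [abs_of_pos (Real.exp_pos _), Real.exp_lt_one_iff]; linarith)).const_mul
      (Real.exp (u * (k - 1 : ℕ)))
    simpa using this
  filter_upwards [hlim.eventually_le_const (show (0 : ℝ) < 1 / 4 by norm_num)] with m hm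
  -- This size makes non-injective maps at most a quarter of all; failing maps are at most another
  -- quarter.
  refine ⟨4 * m ^ 2 + 1, fun V _ _ hV G hG => ?_⟩
  have hpos : 0 < Fintype.card V := by omega
  have : Nonempty V := Fintype.card_pos_iff.1 hpos
  set N : ℝ := ((Fintype.card V : ℕ) : ℝ) with hN
  have hNr : 0 < N := by rw [hN]; exact_mod_cast hpos
  set good := Finset.univ.filter fun x : Fin m → V =>
    ∀ S : Finset (Fin m), S.card + 1 = k → c * m < ((G.pullback x).nbr S).card with hgood
  set noninj := Finset.univ.filter fun x : Fin m → V => ¬ Function.Injective x with hnoninj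
  let valid : (S : Finset (Fin m)) → ({i // i ∈ S} → V) → Prop := fun S a =>
    (Finset.univ.image a).card + 1 = k
  let bad : Finset (Fin m) → Finset (Fin m → V) := fun S =>
    Finset.univ.filter fun x : Fin m → V => valid S (fun i => x i) ∧
      ((Finset.univ.filter fun j => x j ∈
        (fun a : {i // i ∈ S} → V => G.nbr (Finset.univ.image a)) fun i => x i).card : ℝ) ≤ c * m
  have hcover : Finset.univ ⊆
      good ∪ noninj ∪ (Finset.univ.powersetCard (k - 1)).biUnion bad := by
    intro x _
    by_cases hx : Function.Injective x
    swap
    · exact Finset.mem_union_left _ (Finset.mem_union_right _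
        (Finset.mem_filter.2 ⟨Finset.mem_univ _, hx⟩))
    by_cases hxg : x ∈ good
    · exact Finset.mem_union_left _ (Finset.mem_union_left _ hxg)
    apply Finset.mem_union_right
    rw [hgood, Finset.mem_filter] at hxg
    push Not at hxg
    obtain ⟨S, hS, hSc⟩ := hxg (Finset.mem_univ _)
    have himg : (Finset.univ.image fun i : {i // i ∈ S} => x i) = S.image x := by
      ext v; simp
    refine Finset.mem_biUnion.2 ⟨S, Finset.mem_powersetCard.2 ⟨Finset.subset_univ _, by omega⟩,
      Finset.mem_filter.2 ⟨Finset.mem_univ _, ?_, ?_⟩⟩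
    · change (Finset.univ.image fun i : {i // i ∈ S} => x i).card + 1 = k
      rw [himg, Finset.card_image_of_injective _ hx, hS]
    · refine le_trans (Nat.cast_le.2 (Finset.card_le_card fun j hj => ?_)) hSc
      have hj := (Finset.mem_filter.1 hj).2
      rw [mem_nbr_pullback hS, ← himg, ← mem_nbr]
      exact hj
  have hbad : ∀ S ∈ Finset.univ.powersetCard (k - 1), ((bad S).card : ℝ) ≤
      N ^ m * (Real.exp (u * (k - 1 : ℕ)) * (Real.exp (-(u - s * c))) ^ m) := by
    intro S hS
    have hSc := (Finset.mem_powersetCard.1 hS).2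
    have := card_few_hits_le (V := V) S (fun a => G.nbr (Finset.univ.image a)) (valid S)
      (p := c + ε) (s := s) (T := c * m) hs.le (fun a ha => hG _ ha)
    rw [Fintype.card_fin, hSc] at this
    refine le_trans (le_of_eq ?_) (this.trans (le_of_eq ?_))
    · simp only [bad]
      congr!
    rw [← Real.exp_nat_mul, ← Real.exp_add]
    congr 2
    rw [hu]
    ring
  have hsum : (((Finset.univ.powersetCard (k - 1)).biUnion bad).card : ℝ) ≤ 1 / 4 * N ^ m := by
    calc (((Finset.univ.powersetCard (k - 1)).biUnion bad).card : ℝ)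
        ≤ ∑ S ∈ Finset.univ.powersetCard (k - 1), ((bad S).card : ℝ) := by
          exact_mod_cast Finset.card_biUnion_le
      _ ≤ _ := Finset.sum_le_card_nsmul _ _ _ hbad
      _ ≤ (m : ℝ) ^ (k - 1) *
          (N ^ m * (Real.exp (u * (k - 1 : ℕ)) * (Real.exp (-(u - s * c))) ^ m)) := by
          rw [nsmul_eq_mul, Finset.card_powersetCard, Finset.card_univ, Fintype.card_fin]
          gcongr
          exact_mod_cast Nat.choose_le_pow m (k - 1)
      _ = (Real.exp (u * (k - 1 : ℕ)) * ((m : ℝ) ^ (k - 1) *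
          (Real.exp (-(u - s * c))) ^ m)) * N ^ m := by ring
      _ ≤ 1 / 4 * N ^ m := by gcongr
  have hnon : (noninj.card : ℝ) ≤ 1 / 4 * N ^ m := by
    have := card_not_injective_le (ι := Fin m) (V := V)
    rw [Fintype.card_fin] at this
    refine le_trans (le_of_eq ?_) (this.trans ?_)
    · rw [hnoninj]
      congr!
    refine mul_le_mul_of_nonneg_right ?_ (by positivity)
    rw [← hN, div_le_iff₀ hNr]
    have : ((4 * m ^ 2 + 1 : ℕ) : ℝ) ≤ N := Nat.cast_le.2 hV
    push_cast at this
    linarith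
  have htot := Finset.card_le_card hcover
  rw [Finset.card_univ, Fintype.card_fun, Fintype.card_fin] at htot
  have htot' : N ^ m ≤ (good.card : ℝ) + noninj.card +
      ((Finset.univ.powersetCard (k - 1)).biUnion bad).card := by
    have h1 := htot.trans ((Finset.card_union_le _ _).trans
      (Nat.add_le_add_right (Finset.card_union_le _ _) _))
    rw [hN]
    exact_mod_cast h1
  linarith

/-- Supersaturation: if a relative codegree above `c` forces closed tight walks of length `ℓ`,
then a relative codegree of at least `c + ε` forces tight cycles of length `ℓ` in large
hypergraphs. -/
theorem eventually_containsCopy {k ℓ : ℕ} (hk : 0 < k) (hℓ : k ≤ ℓ) {c ε : ℝ} (hc : 0 ≤ c)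
    (hε : 0 < ε)
    (hwalk : ∀ᶠ m : ℕ in atTop, ∀ G : KGraph (Fin m) k,
      (∀ S : Finset (Fin m), S.card + 1 = k → c * m < (G.nbr S).card) →
        ∃ w, G.IsClosedWalk ℓ w) :
    ∀ᶠ n : ℕ in atTop, ∀ G : KGraph (Fin n) k,
      (∀ S : Finset (Fin n), S.card + 1 = k → (c + ε) * n ≤ (G.nbr S).card) →
        G.ContainsCopy (tightCycle k ℓ) := by
  classical
  have : NeZero ℓ := ⟨by omega⟩
  obtain ⟨m, ⟨n₁, hn₁⟩, hw, hm0⟩ := ((eventually_card_good_ge k hc hε).and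
    (hwalk.and (eventually_gt_atTop 0))).exists
  have hmr : (0 : ℝ) < m := by exact_mod_cast hm0
  -- Half of the samples carry a closed walk, and there are m^ℓ candidate words, so one word works
  -- for this proportion.
  set η : ℝ := 1 / 2 / (m : ℝ) ^ ℓ with hη
  have hηpos : 0 < η := by positivity
  obtain ⟨n₂, hn₂⟩ := exists_injective_box (ZMod ℓ) m hηpos
  filter_upwards [eventually_ge_atTop (max n₁ n₂)] with n hn G hG
  have hgood := hn₁ (Fin n) (by rw [Fintype.card_fin]; exact (le_max_left _ _).trans hn) G
    (by rw [Fintype.card_fin]; exact hG)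
  rw [Fintype.card_fin] at hgood
  let H : (ZMod ℓ → Fin m) → Finset (Fin m → Fin n) := fun w =>
    Finset.univ.filter fun x => ∀ i : ZMod ℓ,
      (Finset.range k).image (fun j : ℕ => x (w (i + (j : ZMod ℓ)))) ∈ G.edges
  obtain ⟨w, hwH⟩ : ∃ w, η * (n : ℝ) ^ m ≤ (H w).card := by
    by_contra! hcon
    set good := Finset.univ.filter fun x : Fin m → Fin n =>
      ∀ S : Finset (Fin m), S.card + 1 = k → c * m < ((G.pullback x).nbr S).card with hgooddef
    have hsub : good ⊆ Finset.univ.biUnion H := by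
      intro x hx
      obtain ⟨w, hw'⟩ := hw (G.pullback x) (Finset.mem_filter.1 hx).2
      refine Finset.mem_biUnion.2 ⟨w, Finset.mem_univ _,
        Finset.mem_filter.2 ⟨Finset.mem_univ _, fun i => ?_⟩⟩
      have := (hw' i).2
      rw [Finset.image_image] at this
      exact this
    have h1 : (good.card : ℝ) ≤ ∑ w : ZMod ℓ → Fin m, ((H w).card : ℝ) := by
      exact_mod_cast (Finset.card_le_card hsub).trans Finset.card_biUnion_le
    have hne : (Finset.univ : Finset (ZMod ℓ → Fin m)).Nonempty :=
      ⟨fun _ => ⟨0, hm0⟩, Finset.mem_univ _⟩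
    have h2 : ∑ w : ZMod ℓ → Fin m, ((H w).card : ℝ) <
        ∑ w : ZMod ℓ → Fin m, η * (n : ℝ) ^ m :=
      Finset.sum_lt_sum_of_nonempty hne fun w _ => hcon w
    rw [Finset.sum_const, Finset.card_univ, Fintype.card_fun, ZMod.card, Fintype.card_fin,
      nsmul_eq_mul] at h2
    have h3 : ((m ^ ℓ : ℕ) : ℝ) * (η * (n : ℝ) ^ m) = 1 / 2 * (n : ℝ) ^ m := by
      rw [hη]; push_cast; field_simp
    linarith
  obtain ⟨y, hy, hbox⟩ := hn₂ (Fin n) (by rw [Fintype.card_fin]; exact (le_max_right _ _).trans hn)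
    (H w) (by rw [Fintype.card_fin]; exact hwH)
  have hbox' : ∀ (c : Fin m → ZMod ℓ) (i : ZMod ℓ), (Finset.range k).image
      (fun j : ℕ => y (w (i + (j : ZMod ℓ))) (c (w (i + (j : ZMod ℓ))))) ∈ G.edges :=
    fun c i => (Finset.mem_filter.1 (hbox c)).2 i
  -- The box holds `ℓ` copies of each sampled vertex. Position `i` of the cycle takes copy `i` of `w
  -- i`, which keeps the vertices distinct even where the walk repeats.
  refine ⟨⟨fun i => y (w i) i, fun i i' h => ?_⟩, fun e he => ?_⟩
  · exact congrArg Prod.snd (@hy (w i, i) (w i', i') h)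
  obtain ⟨i, rfl⟩ := (mem_tightCycle_edges hℓ e).1 he
  -- the walk is injective on each window
  have hinj : Set.InjOn (fun j : ℕ => w (i + (j : ZMod ℓ))) (Finset.range k) := by
    have h1 := G.card_eq _ (hbox' (fun _ => 0) i)
    have h2 := Finset.card_image_iff.1 (h1.trans (Finset.card_range k).symm)
    intro a ha b hb hab
    refine h2 ha hb ?_
    simp only at hab ⊢
    rw [hab]
  obtain ⟨cc, hcc⟩ : ∃ cc : Fin m → ZMod ℓ, ∀ j ∈ Finset.range k,
      cc (w (i + (j : ZMod ℓ))) = i + (j : ZMod ℓ) := by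
    refine ⟨fun a => i + ((Function.invFunOn (fun j : ℕ => w (i + (j : ZMod ℓ)))
      (Finset.range k : Set ℕ) a : ℕ) : ZMod ℓ), fun j hj => ?_⟩
    have := hinj.leftInvOn_invFunOn (Finset.mem_coe.2 hj)
    exact congrArg (fun j : ℕ => i + (j : ZMod ℓ)) this
  have := hbox' cc i
  rw [Finset.map_eq_image, Finset.image_image]
  convert this using 1
  refine Finset.image_congr fun j hj => ?_
  change y (w (i + (j : ZMod ℓ))) (i + (j : ZMod ℓ)) = _
  rw [hcc j hj]

end Pullback
end KGraph

namespace KGraph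

/-! ### Lower bound constructions from vertex types. -/

section Types

theorem minCodegree_le_card {V : Type*} [Fintype V] [DecidableEq V] {k : ℕ} (G : KGraph V k) :
    G.minCodegree ≤ Fintype.card V := by
  rw [minCodegree]
  by_cases h : Nonempty {S : Finset V // S.card = k - 1}
  · obtain ⟨S⟩ := h
    refine (ciInf_le (OrderBot.bddBelow _) S).trans ?_
    rw [← card_nbr]
    exact Finset.card_le_univ _
  · rw [not_nonempty_iff] at h
    rw [Nat.iInf_of_empty]
    exact Nat.zero_le _

theorem bddAbove_minCodegree {W : Type*} {k : ℕ} (n : ℕ) (F : KGraph W k) :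
    BddAbove {d : ℕ | ∃ G : KGraph (Fin n) k, ¬ G.ContainsCopy F ∧ G.minCodegree = d} :=
  ⟨n, by
    rintro d ⟨G, -, rfl⟩
    simpa using G.minCodegree_le_card⟩

/-- The vertices of type `c` in `Fin n`, where the type of a vertex is its residue. -/
theorem card_type_ge (p : ℕ) [NeZero p] (n : ℕ) (c : ZMod p) :
    n / p ≤ (Finset.univ.filter fun v : Fin n => ((v : ℕ) : ZMod p) = c).card := by
  have hp : 0 < p := NeZero.pos p
  have hlt : ∀ j : Fin (n / p), c.val + p * j < n := by
    intro j
    have h1 := ZMod.val_lt c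
    have h2 : p * (j + 1) ≤ p * (n / p) := Nat.mul_le_mul_left p j.2
    have h3 := Nat.mul_div_le n p
    rw [Nat.mul_succ] at h2
    omega
  have := Finset.card_le_card_of_injOn (s := (Finset.univ : Finset (Fin (n / p))))
    (t := Finset.univ.filter fun v : Fin n => ((v : ℕ) : ZMod p) = c)
    (fun j => ⟨c.val + p * j, hlt j⟩) (fun j _ => by simp) (fun i _ j _ hij => by
      have h1 := congrArg Fin.val hij
      simp only at h1
      have h2 : p * (i : ℕ) = p * j := by omega
      exact Fin.ext (Nat.eq_of_mul_eq_mul_left hp h2))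
  simpa using this

/-- The hypergraph on `Fin n` whose edges are the `k`-sets with an admissible distribution
of types. -/
def typed (p k n : ℕ) (E : (ZMod p → ℕ) → Prop) : KGraph (Fin n) k where
  edges := {e | e.card = k ∧ E fun c => (e.filter fun v : Fin n => ((v : ℕ) : ZMod p) = c).card}
  card_eq := fun _ h => h.1

/-- If adding type `c` to the distribution of `S` is admissible, all vertices of type `c` outside
`S` are neighbours, at least `n / p - k` of them. A copy of the cycle would give a cyclic word with
all windows admissible. -/
theorem le_exCodegree_of_types {p k ℓ : ℕ} [NeZero p] (hk : 0 < k) (hkℓ : k ≤ ℓ)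
    (E : (ZMod p → ℕ) → Prop)
    (hext : ∀ s : ZMod p → ℕ, ∑ c, s c + 1 = k → ∃ c, E (s + Pi.single c 1))
    (hcyc : ∀ x : ZMod ℓ → ZMod p, ¬ ∀ i : ZMod ℓ,
      E fun c => ((Finset.range k).filter fun j : ℕ => x (i + (j : ZMod ℓ)) = c).card)
    {n : ℕ} (hn : k ≤ n) : n / p - k ≤ exCodegree n (tightCycle k ℓ) := by
  set G := typed p k n E with hG
  have hcopy : ¬ G.ContainsCopy (tightCycle k ℓ) := by
    rintro ⟨f, hf⟩
    refine hcyc (fun i => ((f i : ℕ) : ZMod p)) fun i => ?_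
    have he := (mem_tightCycle_edges hkℓ _).2 ⟨i, rfl⟩
    have hinj : Set.InjOn (fun j : ℕ => i + (j : ZMod ℓ)) (Finset.range k) := by
      have h1 := (tightCycle k ℓ).card_eq _ he
      exact Finset.card_image_iff.1 (h1.trans (Finset.card_range k).symm)
    have h2 := (hf _ he).2
    convert h2 using 2 with c
    rw [Finset.map_eq_image, Finset.image_image, Finset.filter_image,
      Finset.card_image_of_injOn]
    · rfl
    · intro a ha b hb hab
      exact hinj (Finset.mem_of_mem_filter a ha) (Finset.mem_of_mem_filter b hb) (f.injective hab)
  have hmin : n / p - k ≤ G.minCodegree := by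
    obtain ⟨S, -, hS⟩ := Finset.exists_subset_card_eq (s := (Finset.univ : Finset (Fin n)))
      (n := k - 1) (by rw [Finset.card_univ, Fintype.card_fin]; omega)
    have : Nonempty {S : Finset (Fin n) // S.card = k - 1} := ⟨⟨S, hS⟩⟩
    refine le_ciInf fun S => ?_
    obtain ⟨S, hS⟩ := S
    set s : ZMod p → ℕ := fun c => (S.filter fun v : Fin n => ((v : ℕ) : ZMod p) = c).card with hs
    have hsum : ∑ c, s c = S.card := by
      rw [hs, Finset.card_eq_sum_card_fiberwise (t := Finset.univ)
        (f := fun v : Fin n => ((v : ℕ) : ZMod p)) (fun _ _ => by simp)]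
    obtain ⟨c, hc⟩ := hext s (by omega)
    have hsub : (Finset.univ.filter fun v : Fin n => ((v : ℕ) : ZMod p) = c) \ S ⊆ G.nbr S := by
      intro v hv
      obtain ⟨h1, h2⟩ := Finset.mem_sdiff.1 hv
      have h1 := (Finset.mem_filter.1 h1).2
      rw [mem_nbr]
      refine ⟨by rw [Finset.card_insert_of_notMem h2]; omega, ?_⟩
      convert hc using 1
      funext c'
      rw [Finset.filter_insert, Pi.add_apply]
      by_cases hcc : c' = c
      · subst hcc
        rw [if_pos h1, Finset.card_insert_of_notMem (by simp [h2]), Pi.single_eq_same]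
      · rw [if_neg (by rw [h1]; exact Ne.symm hcc), Pi.single_eq_of_ne hcc, add_zero]
    have h1 := Finset.card_le_card hsub
    have h2 := Finset.le_card_sdiff S
      (Finset.univ.filter fun v : Fin n => ((v : ℕ) : ZMod p) = c)
    have h3 := card_type_ge p n c
    change n / p - k ≤ G.codegree S
    rw [← card_nbr]
    omega
  exact hmin.trans (le_csSup (bddAbove_minCodegree n _) ⟨G, hcopy, rfl⟩)

end Types

/-! ### Cyclic words and their windows. -/

section Words

variable {p k ℓ : ℕ}

/-- The number of letters `c` in the window of length `k` that starts at position `i`. -/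
def windowCount (k : ℕ) {ℓ p : ℕ} (x : ZMod ℓ → ZMod p) (i : ZMod ℓ) (c : ZMod p) : ℕ :=
  ((Finset.range k).filter fun j : ℕ => x (i + (j : ZMod ℓ)) = c).card

theorem windowCount_succ (x : ZMod ℓ → ZMod p) (i : ZMod ℓ) (c : ZMod p) :
    windowCount k x (i + 1) c + (if c = x i then 1 else 0) =
      windowCount k x i c + (if c = x (i + (k : ZMod ℓ)) then 1 else 0) := by
  simp only [windowCount, Finset.card_filter]
  have h1 := Finset.sum_range_succ (fun j : ℕ => if x (i + (j : ZMod ℓ)) = c then 1 else 0) k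
  have h2 := Finset.sum_range_succ' (fun j : ℕ => if x (i + (j : ZMod ℓ)) = c then 1 else 0) k
  simp only [Nat.cast_zero, add_zero, Nat.cast_add, Nat.cast_one] at h1 h2
  have h3 : ∀ j : ℕ, i + ((j : ZMod ℓ) + 1) = i + 1 + (j : ZMod ℓ) := fun j => by ring
  simp only [h3] at h2
  simp only [eq_comm (a := c)]
  omega

/-- A property of positions that is invariant under the shift by `k` holds in each window
a number of times that is divisible by `k / gcd k ℓ`. -/
theorem dvd_card_window (hℓ : 0 < ℓ) (Y : ZMod ℓ → Prop) [DecidablePred Y]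
    (hY : ∀ i, Y (i + (k : ZMod ℓ)) ↔ Y i) (i : ZMod ℓ) :
    k / Nat.gcd k ℓ ∣ ((Finset.range k).filter fun j : ℕ => Y (i + (j : ZMod ℓ))).card := by
  have : NeZero ℓ := ⟨hℓ.ne'⟩
  set g := Nat.gcd k ℓ with hg
  have hmul : ∀ (a : ℕ) (i : ZMod ℓ), Y (i + (a : ZMod ℓ) * (k : ZMod ℓ)) ↔ Y i := by
    intro a
    induction a with
    | zero => simp
    | succ a ih =>
      intro i
      rw [← ih i, ← hY (i + (a : ZMod ℓ) * (k : ZMod ℓ))]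
      push_cast
      ring_nf
  have hgY : ∀ i, Y (i + (g : ZMod ℓ)) ↔ Y i := by
    intro i
    -- By Bézout, `g` is a multiple of `k` modulo `ℓ`, so `Y` has period `g` and a window consists
    -- of `k / g` equal periods.
    have h1 : ((g : ℕ) : ZMod ℓ) = ((Nat.gcdA k ℓ : ℤ) : ZMod ℓ) * (k : ZMod ℓ) := by
      have := congrArg (fun z : ℤ => (z : ZMod ℓ)) (Nat.gcd_eq_gcd_ab k ℓ)
      simp only [Int.cast_natCast, Int.cast_add, Int.cast_mul, CharP.cast_eq_zero, zero_mul,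
        add_zero] at this
      rw [hg, this, mul_comm]
    have h2 : ((Nat.gcdA k ℓ : ℤ) : ZMod ℓ) =
        ((((Nat.gcdA k ℓ : ℤ) : ZMod ℓ).val : ℕ) : ZMod ℓ) := by simp
    rw [h1, h2, hmul]
  have hcount : ∀ d, Nat.count (fun j : ℕ => Y (i + (j : ZMod ℓ))) (d * g) =
      d * Nat.count (fun j : ℕ => Y (i + (j : ZMod ℓ))) g := by
    intro d
    induction d with
    | zero => simp
    | succ d ih =>
      rw [Nat.succ_mul, Nat.count_add, ih, Nat.succ_mul]
      congr 1
      have : (fun j : ℕ => Y (i + ((d * g + j : ℕ) : ZMod ℓ))) =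
          fun j : ℕ => Y (i + (j : ZMod ℓ)) := by
        funext j
        refine propext ?_
        clear ih
        induction d with
        | zero => simp
        | succ d ih2 =>
          rw [← ih2, ← hgY (i + ((d * g + j : ℕ) : ZMod ℓ))]
          push_cast
          ring_nf
      simp only [this]
  refine ⟨Nat.count (fun j : ℕ => Y (i + (j : ZMod ℓ))) g, ?_⟩
  rw [← hcount, Nat.div_mul_cancel (Nat.gcd_dvd_left k ℓ), Nat.count_eq_card_filter_range]

/-- The sum of the types, counted with multiplicity. -/
def typeSum {p : ℕ} [NeZero p] (v : ZMod p → ℕ) : ZMod p := ∑ c, (v c : ZMod p) * c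

variable [NeZero p]

theorem typeSum_step {v v' : ZMod p → ℕ} {a b : ZMod p}
    (h : ∀ c, v' c + (if c = a then 1 else 0) = v c + (if c = b then 1 else 0)) :
    typeSum v' + a = typeSum v + b := by
  have h1 : ∑ c, ((v' c + (if c = a then 1 else 0) : ℕ) : ZMod p) * c =
      ∑ c, ((v c + (if c = b then 1 else 0) : ℕ) : ZMod p) * c :=
    Finset.sum_congr rfl fun c _ => by rw [h c]
  push_cast at h1
  simp only [add_mul, Finset.sum_add_distrib, ite_mul, one_mul, zero_mul, Finset.sum_ite_eq',
    Finset.mem_univ, if_true] at h1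
  exact h1

theorem typeSum_add_single (s : ZMod p → ℕ) (c : ZMod p) :
    typeSum (s + Pi.single c 1) = typeSum s + c := by
  simp [typeSum, Pi.single_apply, add_mul, Finset.sum_add_distrib]

theorem dvd_windowCount (hℓ : 0 < ℓ) {x : ZMod ℓ → ZMod p} {c : ZMod p}
    (hx : ∀ i, x (i + (k : ZMod ℓ)) = c ↔ x i = c) (i : ZMod ℓ) :
    k / Nat.gcd k ℓ ∣ windowCount k x i c :=
  dvd_card_window hℓ (fun i => x i = c) hx i

theorem typeSum_eq_zero {d : ℕ} (hpd : p ∣ d) {v : ZMod p → ℕ} (h : ∀ c, d ∣ v c) :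
    typeSum v = 0 := by
  refine Finset.sum_eq_zero fun c _ => ?_
  rw [(ZMod.natCast_eq_zero_iff _ _).2 (hpd.trans (h c)), zero_mul]

/-- Sliding the window by one position drops `x i` and gains `x (i + k)`. -/
theorem eq_of_typeSum_eq {x : ZMod ℓ → ZMod p} {i : ZMod ℓ}
    (h : typeSum (windowCount k x (i + 1)) = typeSum (windowCount k x i)) :
    x (i + (k : ZMod ℓ)) = x i := by
  have := typeSum_step (windowCount_succ (k := k) x i)
  rw [h] at this
  exact (add_left_cancel this).symm

/-- The lower bound if a prime `p` divides `k / gcd k ℓ`. -/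
theorem le_exCodegree_of_dvd (hk : 0 < k) (hkℓ : k ≤ ℓ) (hp : 1 < p)
    (hpd : p ∣ k / Nat.gcd k ℓ) {n : ℕ} (hn : k ≤ n) :
    n / p - k ≤ exCodegree n (tightCycle k ℓ) := by
  have : Fact (1 < p) := ⟨hp⟩
  refine le_exCodegree_of_types hk hkℓ (fun v : ZMod p → ℕ => typeSum v = 1)
    (fun s _ => ⟨1 - typeSum s, by rw [typeSum_add_single]; ring⟩) (fun x hx => ?_) hn
  have hx' : ∀ i, typeSum (windowCount k x i) = 1 := hx
  have hper : ∀ i, x (i + (k : ZMod ℓ)) = x i := fun i =>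
    eq_of_typeSum_eq (by rw [hx', hx'])
  have h0 := typeSum_eq_zero hpd fun c =>
    dvd_windowCount (k := k) (by omega) (fun i => by rw [hper]) 0 (x := x) (c := c)
  rw [hx'] at h0
  exact one_ne_zero h0

end Words

/-! ### Three types when gcd(k, ℓ) is at most 3. -/

section ThreeTypes

/-- The type distributions that arise from a distribution without the type `c - ω`, all of
whose entries are divisible by `d`, when the type of one element is changed from `c`
to `c + ω`. -/
structure NearDiv (d : ℕ) (c ω : ZMod 3) (v : ZMod 3 → ℕ) : Prop where
  ne : ω ≠ 0
  missing : v (c - ω) = 0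
  less : (v c : ZMod d) = -1
  more : (v (c + ω) : ZMod d) = 1
  sum : typeSum v = 1 + ω
  orient : v (c + ω) = 1 → ω = 1

/-- The admissible type distributions. -/
def Admissible (d : ℕ) (v : ZMod 3 → ℕ) : Prop :=
  (typeSum v = 1 ∧ ¬ ∀ c, d ∣ v c) ∨ ∃ c ω, NearDiv d c ω v

/-- The type distributions that can be reached from a distribution as in `NearDiv`. -/
def NearDivOrNext (d : ℕ) (c ω : ZMod 3) (v : ZMod 3 → ℕ) : Prop :=
  NearDiv d c ω v ∨ (ω ≠ 0 ∧ v (c - ω) = 1 ∧ (v c : ZMod d) = -2 ∧ (v (c + ω) : ZMod d) = 1 ∧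
    typeSum v = 1 ∧ (v (c + ω) = 1 → ω = 1))

theorem zmod_three_cases : ∀ c ω a : ZMod 3, ω ≠ 0 → a = c ∨ a = c + ω ∨ a = c - ω := by decide

theorem NearDiv.residue {d : ℕ} {c ω : ZMod 3} {v : ZMod 3 → ℕ} (h : NearDiv d c ω v)
    (a : ZMod 3) : (v a : ZMod d) = -1 ∨ (v a : ZMod d) = 1 ∨ (v a : ZMod d) = 0 := by
  rcases zmod_three_cases c ω a h.ne with rfl | rfl | rfl
  · exact Or.inl h.less
  · exact Or.inr (Or.inl h.more)
  · exact Or.inr (Or.inr (by rw [h.missing, Nat.cast_zero]))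

theorem NearDiv.sum_ne {d : ℕ} {c ω : ZMod 3} {v : ZMod 3 → ℕ} (h : NearDiv d c ω v) :
    typeSum v ≠ 1 := by
  rw [h.sum]
  have := h.ne
  simpa using this

/-- Checking which letter leaves and which enters, residues and type sums leave only exchanges
between `c` and `c - ω`. So type `c + ω` enters exactly when it leaves, which makes it periodic. -/
theorem NearDivOrNext.step {d : ℕ} (h1 : (1 : ZMod d) ≠ 0) (h2 : (2 : ZMod d) ≠ 0)
    (h3 : (3 : ZMod d) ≠ 0) {c ω a b : ZMod 3} {v v' : ZMod 3 → ℕ} (hv : NearDivOrNext d c ω v)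
    (hv' : Admissible d v')
    (hstep : ∀ t, v' t + (if t = a then 1 else 0) = v t + (if t = b then 1 else 0)) :
    NearDivOrNext d c ω v' ∧ (b = c + ω ↔ a = c + ω) := by
  by_cases hab : a = b
  · subst hab
    obtain rfl : v' = v := funext fun t => by simpa using hstep t
    exact ⟨hv, Iff.rfl⟩
  have hω : ω ≠ 0 := by rcases hv with h | h; exacts [h.ne, h.1]
  have hsum := typeSum_step hstep
  have n1 : c ≠ c + ω := (by decide : ∀ c ω : ZMod 3, ω ≠ 0 → c ≠ c + ω) c ω hω
  have n2 : c ≠ c - ω := (by decide : ∀ c ω : ZMod 3, ω ≠ 0 → c ≠ c - ω) c ω hω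
  have n3 : c + ω ≠ c - ω := (by decide : ∀ c ω : ZMod 3, ω ≠ 0 → c + ω ≠ c - ω) c ω hω
  have n5 : ω + ω ≠ 0 := (by decide : ∀ ω : ZMod 3, ω ≠ 0 → ω + ω ≠ 0) ω hω
  have two_ne : ∀ t : ZMod 3, (v' t : ZMod d) = 2 → ∀ c' ω', ¬ NearDiv d c' ω' v' := by
    intro t ht c' ω' h
    rcases h.residue t with h' | h' | h'
    · exact h3 (by linear_combination h' - ht)
    · exact h1 (by linear_combination ht.symm.trans h')
    · exact h2 (ht.symm.trans h')
  -- the distribution with residues `-1, 0, 1` would have the wrong orientation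
  have orient : (v' c : ZMod d) = -1 → (v' (c - ω) : ZMod d) = 1 → v' (c - ω) = 1 →
      (v' (c + ω) = 0 → ω = 1) → ∀ c' ω', ¬ NearDiv d c' ω' v' := by
    intro e1 e2 e3 e4 c' ω' h
    have hc : c = c' := by
      rcases zmod_three_cases c' ω' c h.ne with h' | h' | h'
      · exact h'
      · have := h.more
        rw [← h', e1] at this
        exact absurd (by linear_combination -this) h2
      · have := h.missing
        rw [← h'] at this
        rw [this, Nat.cast_zero] at e1
        exact absurd (by linear_combination e1) h1
    subst hc
    have hw : ω' = -ω := by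
      have h6 := h.missing
      have h5 := h.ne
      have h7 : ω' ≠ ω := by
        rintro rfl
        rw [e3] at h6
        exact one_ne_zero h6
      exact (by decide : ∀ ω ω' : ZMod 3, ω ≠ 0 → ω' ≠ 0 → ω' ≠ ω → ω' = -ω) ω ω' hω h5 h7
    subst hw
    have h6 := h.missing
    rw [sub_neg_eq_add] at h6
    have h8 := h.orient
    rw [← sub_eq_add_neg] at h8
    have := h8 e3
    rw [e4 h6] at this
    exact absurd this (by decide)
  have s1 := hstep c
  have s2 := hstep (c + ω)
  have s3 := hstep (c - ω)
  have r1 := congrArg (fun z : ℕ => (z : ZMod d)) s1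
  have r2 := congrArg (fun z : ℕ => (z : ZMod d)) s2
  have r3 := congrArg (fun z : ℕ => (z : ZMod d)) s3
  push_cast at r1 r2 r3
  have wrong : typeSum v' ≠ 1 → (∀ c' ω', ¬ NearDiv d c' ω' v') → False := by
    rintro e1 e2
    rcases hv' with h | ⟨c', ω', h⟩
    · exact e1 h.1
    · exact e2 c' ω' h
  have z : ∀ t : ZMod 3, t ≠ 0 → typeSum v' = 1 + t → typeSum v' ≠ 1 := by
    intro t ht h h'
    rw [h'] at h
    exact ht (by linear_combination -h)
  rcases zmod_three_cases c ω a hω with ha | ha | ha <;>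
    rcases zmod_three_cases c ω b hω with hb | hb | hb <;>
    simp only [ha, hb, n1, n2, n3, n1.symm, n2.symm, n3.symm, if_true, if_false, add_zero] at s1 s2 s3 r1 r2 r3 hsum
  · exact absurd (ha.trans hb.symm) hab
  · exfalso
    rcases hv with h | ⟨-, v3, v1, v2, vs, vo⟩
    · refine wrong (z (ω + ω) n5 ?_) (two_ne (c + ω) ?_)
      · rw [h.sum] at hsum; linear_combination hsum
      · rw [h.more] at r2; linear_combination r2
    · refine wrong (z ω hω ?_) (two_ne (c + ω) ?_)
      · rw [vs] at hsum; linear_combination hsum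
      · rw [v2] at r2; linear_combination r2
  · rcases hv with h | ⟨-, v3, v1, v2, vs, vo⟩
    · refine ⟨Or.inr ⟨hω, ?_, ?_, ?_, ?_, ?_⟩, ?_⟩
      · rw [s3, h.missing]
      · rw [h.less] at r1; linear_combination r1
      · rw [r2, h.more]
      · rw [h.sum] at hsum; linear_combination hsum
      · rw [s2]; exact h.orient
      · rw [ha, hb]; simp [n1, n3.symm]
    · exfalso
      refine wrong (z (-ω) (neg_ne_zero.2 hω) ?_) (two_ne (c - ω) ?_)
      · rw [vs] at hsum; linear_combination hsum
      · rw [v3] at r3; rw [r3]; norm_num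
  · exfalso
    rcases hv with h | ⟨-, v3, v1, v2, vs, vo⟩
    · have hs : typeSum v' = 1 := by rw [h.sum] at hsum; linear_combination hsum
      rcases hv' with h' | ⟨c', ω', h'⟩
      -- This step would undo the change of type and restore a distribution divisible by `d`, which
      -- is not admissible.
      · refine h'.2 fun t => ?_
        rw [← ZMod.natCast_eq_zero_iff]
        rcases zmod_three_cases c ω t hω with ht | ht | ht
        · rw [ht, r1, h.less]; ring
        · rw [ht]; rw [h.more] at r2; linear_combination r2
        · rw [ht, r3, h.missing, Nat.cast_zero]
      · exact h'.sum_ne hs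
    · refine wrong (z (-ω) (neg_ne_zero.2 hω) ?_) (orient ?_ ?_ ?_ ?_)
      · rw [vs] at hsum; linear_combination hsum
      · rw [r1, v1]; ring
      · rw [r3, v3, Nat.cast_one]
      · rw [s3, v3]
      · intro h0; exact vo (by omega)
  · exact absurd (ha.trans hb.symm) hab
  · exfalso
    rcases hv with h | ⟨-, v3, v1, v2, vs, vo⟩
    · refine wrong (z (-ω) (neg_ne_zero.2 hω) ?_) (orient ?_ ?_ ?_ ?_)
      · rw [h.sum] at hsum; linear_combination hsum
      · rw [r1, h.less]
      · rw [r3, h.missing]; simp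
      · rw [s3, h.missing]
      · intro h0; exact h.orient (by omega)
    · refine wrong (z (-(ω + ω)) (neg_ne_zero.2 n5) ?_) (two_ne (c - ω) ?_)
      · rw [vs] at hsum; linear_combination hsum
      · rw [r3, v3]; norm_num
  · rcases hv with h | ⟨-, v3, v1, v2, vs, vo⟩
    · have := h.missing
      omega
    · refine ⟨Or.inl ⟨hω, by omega, ?_, ?_, ?_, ?_⟩, ?_⟩
      · rw [r1, v1]; ring
      · rw [r2, v2]
      · rw [vs] at hsum; linear_combination hsum
      · rw [s2]; exact vo
      · rw [ha, hb]; simp [n1, n3.symm]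
  · exfalso
    rcases hv with h | ⟨-, v3, v1, v2, vs, vo⟩
    · have := h.missing
      omega
    · refine wrong (z (ω + ω) n5 ?_) (two_ne (c + ω) ?_)
      · rw [vs] at hsum; linear_combination hsum
      · rw [r2, v2]; norm_num
  · exact absurd (ha.trans hb.symm) hab

/-- If all three types occurred, each would occur exactly `d` times, with type sum d(0 + 1 + 2) = 0.
-/
theorem exists_eq_zero_of_dvd {d g : ℕ} (hg : g ≤ 3) (hd : 0 < d) {v : ZMod 3 → ℕ}
    (hv : ∑ c, v c = d * g) (hs : typeSum v = 1) (h : ∀ c, d ∣ v c) : ∃ c, v c = 0 := by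
  by_contra! h0
  choose a ha using h
  have hpos : ∀ c, 1 ≤ a c := fun c => by
    rcases Nat.eq_zero_or_pos (a c) with h1 | h1
    · exact absurd (by rw [ha, h1, mul_zero]) (h0 c)
    · exact h1
  have hsum : ∑ c, a c = g := by
    refine Nat.eq_of_mul_eq_mul_left hd ?_
    rw [Finset.mul_sum, ← hv]
    exact Finset.sum_congr rfl fun c _ => (ha c).symm
  have h3 : a 0 + a 1 + a 2 = g := by
    rw [← hsum]
    exact (Fin.sum_univ_three a).symm
  have p0 := hpos 0
  have p1 := hpos 1
  have p2 := hpos 2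
  have ha1 : ∀ c, a c = 1 := by
    intro c
    have : ∀ c : ZMod 3, c = 0 ∨ c = 1 ∨ c = 2 := by decide
    rcases this c with rfl | rfl | rfl <;> omega
  have : typeSum v = 0 := by
    have h4 : typeSum v = ∑ c : ZMod 3, (d : ZMod 3) * c :=
      Finset.sum_congr rfl fun c _ => by rw [ha, ha1, mul_one]
    rw [h4, ← Finset.mul_sum, (by decide : ∑ c : ZMod 3, c = 0), mul_zero]
  rw [hs] at this
  exact one_ne_zero this

/-- The lower bound `1 / 3` if `gcd k ℓ ≤ 3`. -/
theorem le_exCodegree_of_gcd_le {k ℓ : ℕ} (hk : 0 < k) (hkℓ : k ≤ ℓ) (hg : Nat.gcd k ℓ ≤ 3)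
    (hd : 3 < k / Nat.gcd k ℓ) {n : ℕ} (hn : k ≤ n) :
    n / 3 - k ≤ exCodegree n (tightCycle k ℓ) := by
  set d := k / Nat.gcd k ℓ with hdef
  have hne : ∀ j : ℕ, 0 < j → j ≤ 3 → ((j : ℕ) : ZMod d) ≠ 0 := by
    intro j hj hj3 h
    have := Nat.le_of_dvd hj ((ZMod.natCast_eq_zero_iff _ _).1 h)
    omega
  have h1 : (1 : ZMod d) ≠ 0 := by simpa using hne 1 (by norm_num) (by norm_num)
  have h2 : (2 : ZMod d) ≠ 0 := by simpa using hne 2 (by norm_num) (by norm_num)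
  have h3 : (3 : ZMod d) ≠ 0 := by simpa using hne 3 (by norm_num) (by norm_num)
  have hdg : d * Nat.gcd k ℓ = k := Nat.div_mul_cancel (Nat.gcd_dvd_left k ℓ)
  refine le_exCodegree_of_types hk hkℓ (Admissible d) (fun s hs => ?_) (fun x hx => ?_) hn
  · set c := 1 - typeSum s with hc
    set v := s + Pi.single c 1 with hv
    have hvs : typeSum v = 1 := by rw [hv, typeSum_add_single, hc]; ring
    have hvsum : ∑ c, v c = d * Nat.gcd k ℓ := by
      simp [hv, Finset.sum_add_distrib, hdg, hs]
    by_cases hbad : ∀ c, d ∣ v c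
    swap
    · exact ⟨c, Or.inl ⟨hvs, hbad⟩⟩
    obtain ⟨c2, hc2⟩ := exists_eq_zero_of_dvd hg (by omega) hvsum hvs hbad
    have hvc : v c = s c + 1 := by simp [hv]
    have hvne : ∀ t, t ≠ c → v t = s t := fun t ht => by simp [hv, ht]
    have near : ∀ ω : ZMod 3, ω ≠ 0 → v (c - ω) = 0 → (v (c + ω) = 0 → ω = 1) →
        ∃ c, Admissible d (s + Pi.single c 1) := by
      intro ω hω h0 hor
      have n1 : c ≠ c + ω := (by decide : ∀ c ω : ZMod 3, ω ≠ 0 → c ≠ c + ω) c ω hω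
      have n2 : c ≠ c - ω := (by decide : ∀ c ω : ZMod 3, ω ≠ 0 → c ≠ c - ω) c ω hω
      have n3 : c + ω ≠ c - ω := (by decide : ∀ c ω : ZMod 3, ω ≠ 0 → c + ω ≠ c - ω) c ω hω
      refine ⟨c + ω, Or.inr ⟨c, ω, hω, ?_, ?_, ?_, ?_, ?_⟩⟩
      · rw [Pi.add_apply, Pi.single_eq_of_ne n3.symm, ← hvne _ n2.symm, h0, add_zero]
      · rw [Pi.add_apply, Pi.single_eq_of_ne n1, add_zero]
        have := (ZMod.natCast_eq_zero_iff _ _).2 (hbad c)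
        rw [hvc] at this
        push_cast at this
        linear_combination this
      · rw [Pi.add_apply, Pi.single_eq_same, ← hvne _ n1.symm]
        push_cast
        rw [(ZMod.natCast_eq_zero_iff _ _).2 (hbad (c + ω)), zero_add]
      · rw [typeSum_add_single, hc]; ring
      · rw [Pi.add_apply, Pi.single_eq_same, ← hvne _ n1.symm]
        intro h
        exact hor (by omega)
    -- Type `c` occurs, so a missing type is `c - 1` or `c + 1`, and `ω` is chosen with `c - ω`
    -- missing. If both are missing, `ω = 1`: the tie-break in `NearDiv.orient`, which rules out
    -- drifting from one orientation to the other.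
    by_cases hz : v (c - 1) = 0
    · exact near 1 (by decide) hz fun _ => rfl
    · refine near (-1) (by decide) ?_ ?_
      · rcases zmod_three_cases c 1 c2 (by decide) with h | h | h
        · rw [h, hvc] at hc2; omega
        · rw [sub_neg_eq_add, ← h, hc2]
        · rw [h] at hc2; exact absurd hc2 hz
      · intro h
        rw [← sub_eq_add_neg] at h
        exact absurd h hz
  · have hx' : ∀ i, Admissible d (windowCount k x i) := hx
    have hℓ : 0 < ℓ := by omega
    -- After one nearly divisible window, `c + ω` has period `k`, so its count is divisible by `d`,
    -- against the residue 1. If there is no such window, the constant type sum makes all counts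
    -- divisible by `d`.
    by_cases hN : ∃ i c ω, NearDiv d c ω (windowCount k x i)
    · obtain ⟨i, c, ω, hi⟩ := hN
      have hall : ∀ n : ℕ, NearDivOrNext d c ω (windowCount k x (i + (n : ZMod ℓ))) := by
        intro n
        induction n with
        | zero => rw [Nat.cast_zero, add_zero]; exact Or.inl hi
        | succ n ih =>
          have := (ih.step h1 h2 h3 (hx' _) (windowCount_succ x _)).1
          rwa [Nat.cast_add, Nat.cast_one, ← add_assoc]
      have : NeZero ℓ := ⟨hℓ.ne'⟩
      have hper : ∀ j, x (j + (k : ZMod ℓ)) = c + ω ↔ x j = c + ω := by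
        intro j
        have h := hall (j - i).val
        rw [ZMod.natCast_zmod_val, add_sub_cancel] at h
        exact (h.step h1 h2 h3 (hx' _) (windowCount_succ x _)).2
      have hdvd := dvd_windowCount (k := k) hℓ hper i
      have h4 := hi.more
      rw [(ZMod.natCast_eq_zero_iff _ _).2 hdvd] at h4
      exact h1 h4.symm
    · have hE : ∀ i, typeSum (windowCount k x i) = 1 ∧ ¬ ∀ c, d ∣ windowCount k x i c := by
        intro i
        rcases hx' i with h | ⟨c, ω, h⟩
        · exact h
        · exact absurd ⟨i, c, ω, h⟩ hN
      have hper : ∀ i, x (i + (k : ZMod ℓ)) = x i := fun i =>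
        eq_of_typeSum_eq (by rw [(hE _).1, (hE _).1])
      exact (hE 0).2 fun c => dvd_windowCount hℓ (fun i => by rw [hper]) 0

end ThreeTypes
end KGraph

namespace KGraph

/-! ### From bounds to the limit. -/

section Density

theorem hasCodegreeTuranDensity_of_bounds {k ℓ p : ℕ} (hk : 0 < k) (hkℓ : k ≤ ℓ) (hp : 0 < p)
    (hlow : ∀ n, k ≤ n → n / p - k ≤ exCodegree n (tightCycle k ℓ))
    (hwalk : ∀ᶠ m : ℕ in atTop, ∀ G : KGraph (Fin m) k,
      (∀ S : Finset (Fin m), S.card + 1 = k → 1 / (p : ℝ) * m < (G.nbr S).card) →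
        ∃ w, G.IsClosedWalk ℓ w) :
    (tightCycle k ℓ).HasCodegreeTuranDensity (1 / (p : ℝ)) := by
  have hpr : (0 : ℝ) < p := by exact_mod_cast hp
  refine tendsto_order.2 ⟨fun a ha => ?_, fun a ha => ?_⟩
  · have hlim : Tendsto (fun n : ℕ => 1 / (p : ℝ) - ((k : ℝ) + 1) / (n : ℝ)) atTop
        (𝓝 (1 / (p : ℝ))) := by
      simpa using (tendsto_const_nhds (x := 1 / (p : ℝ))).sub
        (tendsto_const_div_atTop_nhds_zero_nat ((k : ℝ) + 1))
    filter_upwards [hlim.eventually_const_lt ha, eventually_ge_atTop k] with n hn hkn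
    refine hn.trans_le ?_
    have hnr : (0 : ℝ) < n := by exact_mod_cast (by omega : 0 < n)
    rw [le_div_iff₀ hnr, sub_mul, div_mul_cancel₀ _ hnr.ne']
    have h1 : n / p ≤ exCodegree n (tightCycle k ℓ) + k := by
      have := hlow n hkn
      omega
    have h2 : ((n / p : ℕ) : ℝ) ≤ exCodegree n (tightCycle k ℓ) + k := by exact_mod_cast h1
    have h3 : (n : ℝ) / p < (n / p : ℕ) + 1 := by
      rw [div_lt_iff₀ hpr]
      have := Nat.lt_mul_div_succ n hp
      rw [mul_comm] at this
      exact_mod_cast this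
    have h4 : 1 / (p : ℝ) * n = n / p := by ring
    linarith
  · have hε : 0 < (a - 1 / (p : ℝ)) / 2 := by linarith
    have hup := eventually_containsCopy hk hkℓ (c := 1 / (p : ℝ)) (by positivity) hε hwalk
    filter_upwards [hup, eventually_ge_atTop k] with n hn hkn
    have hnr : (0 : ℝ) < n := by exact_mod_cast (by omega : 0 < n)
    rw [div_lt_iff₀ hnr]
    have ha0 : 0 < a := lt_trans (by positivity) ha
    rcases Set.eq_empty_or_nonempty
      {d : ℕ | ∃ G : KGraph (Fin n) k, ¬ G.ContainsCopy (tightCycle k ℓ) ∧ G.minCodegree = d}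
      with hempty | hne
    -- If every hypergraph on `n` vertices contains the cycle, the supremum takes its default value
    -- 0.
    · rw [exCodegree, hempty, csSup_empty, Nat.bot_eq_zero, Nat.cast_zero]
      positivity
    · obtain ⟨G, hG, hd⟩ := Nat.sSup_mem hne (bddAbove_minCodegree n _)
      change G.minCodegree = exCodegree n (tightCycle k ℓ) at hd
      by_contra! hcon
      refine hG (hn G fun S hS => ?_)
      have h1 : G.minCodegree ≤ G.codegree S :=
        ciInf_le (OrderBot.bddBelow _) (⟨S, by omega⟩ : {S : Finset (Fin n) // S.card = k - 1})
      rw [hd, ← card_nbr] at h1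
      have h2 : (exCodegree n (tightCycle k ℓ) : ℝ) ≤ (G.nbr S).card := Nat.cast_le.2 h1
      have h3 : (1 / (p : ℝ) + (a - 1 / (p : ℝ)) / 2) * n ≤ a * n := by
        gcongr
        linarith
      linarith

theorem le_of_sq_le {k ℓ : ℕ} (hℓ : 20 * k ^ 2 ≤ ℓ) : k ≤ ℓ := by nlinarith [Nat.le_mul_self k]

/-- The density `1 / 2`. -/
theorem hasCodegreeTuranDensity_half {k ℓ : ℕ} (hk : 3 ≤ k) (hℓ : 20 * k ^ 2 ≤ ℓ)
    (hd : 2 ∣ k / Nat.gcd k ℓ) : (tightCycle k ℓ).HasCodegreeTuranDensity (1 / 2) := by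
  have hkℓ := le_of_sq_le hℓ
  have := hasCodegreeTuranDensity_of_bounds (p := 2) (by omega) hkℓ (by norm_num)
    (fun n hn => le_exCodegree_of_dvd (by omega) hkℓ (by norm_num) hd hn) (by
      filter_upwards [eventually_ge_atTop k] with m hm G hG
      refine exists_closedWalk_of_half (δ := m / 2 + 1) (by omega)
        (by rwa [Fintype.card_fin]) (fun S hS => ?_) (by rw [Fintype.card_fin]; omega) hℓ
      have h1 := hG S hS
      have h2 : (m : ℝ) < 2 * (G.nbr S).card := by push_cast at h1; linarith
      have h3 : m < 2 * (G.nbr S).card := by exact_mod_cast h2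
      omega)
  exact_mod_cast this

/-- The density `1 / 3`. -/
theorem hasCodegreeTuranDensity_third {k ℓ : ℕ} (hk : 3 ≤ k) (hℓ : 20 * k ^ 2 ≤ ℓ)
    (hodd : Odd (k / Nat.gcd k ℓ))
    (hd : 3 ∣ k / Nat.gcd k ℓ ∨ (Nat.gcd k ℓ ≤ 3 ∧ 3 < k / Nat.gcd k ℓ)) :
    (tightCycle k ℓ).HasCodegreeTuranDensity (1 / 3) := by
  have hkℓ := le_of_sq_le hℓ
  have := hasCodegreeTuranDensity_of_bounds (p := 3) (by omega) hkℓ (by norm_num)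
    (fun n hn => by
      rcases hd with hd | ⟨h1, h2⟩
      · exact le_exCodegree_of_dvd (by omega) hkℓ (by norm_num) hd hn
      · exact le_exCodegree_of_gcd_le (by omega) hkℓ h1 h2 hn) (by
      filter_upwards [eventually_ge_atTop k] with m hm G hG
      refine DenseThird.exists_closedWalk (δ := m / 3 + 1) ⟨fun S hS => ?_, hk,
        by rwa [Fintype.card_fin], by omega, by rw [Fintype.card_fin]; omega⟩ hℓ hodd
      have h1 := hG S hS
      have h2 : (m : ℝ) < 3 * (G.nbr S).card := by push_cast at h1; linarith
      have h3 : m < 3 * (G.nbr S).card := by exact_mod_cast h2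
      omega)
  exact_mod_cast this

end Density

end KGraph

/-! ### Natural density of the coprime lengths. -/

section NaturalDensity

theorem count_coprime_mul (k a : ℕ) :
    Nat.count (fun ℓ => Nat.gcd k ℓ = 1) (a * k) = a * Nat.totient k := by
  induction a with
  | zero => simp
  | succ a ih =>
    rw [Nat.succ_mul, Nat.count_add, ih, Nat.succ_mul]
    congr 1
    have h1 : (fun j => Nat.gcd k (a * k + j) = 1) = fun j => Nat.gcd k j = 1 := by
      funext j
      rw [Nat.add_comm, Nat.gcd_add_mul_right_right]
    simp only [h1]
    rw [Nat.count_eq_card_filter_range, Nat.totient_eq_card_coprime]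

theorem hasNaturalDensity_coprime {k : ℕ} (hk : 0 < k) (C : ℕ) (hC : 0 < C) :
    HasNaturalDensity {ℓ : ℕ | C ≤ ℓ ∧ Nat.gcd k ℓ = 1} ((Nat.totient k : ℝ) / (k : ℝ)) := by
  have hkr : (0 : ℝ) < k := by exact_mod_cast hk
  set φ := Nat.totient k with hφ
  -- Each full period of `k` integers contributes `φ`, and the cut-off at `C` removes at most `C`.
  have hbounds : ∀ N : ℕ,
      ({ℓ : ℕ | C ≤ ℓ ∧ Nat.gcd k ℓ = 1} ∩ Set.Icc 1 N).ncard ≤ (N / k + 1) * φ ∧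
      N / k * φ ≤ ({ℓ : ℕ | C ≤ ℓ ∧ Nat.gcd k ℓ = 1} ∩ Set.Icc 1 N).ncard + C := by
    intro N
    have h1 : {ℓ : ℕ | C ≤ ℓ ∧ Nat.gcd k ℓ = 1} ∩ Set.Icc 1 N =
        (((Finset.range (N + 1)).filter fun ℓ => Nat.gcd k ℓ = 1) \ Finset.range C : Finset ℕ) := by
      ext ℓ
      simp only [Set.mem_inter_iff, Set.mem_ofPred_eq, Set.mem_Icc, Finset.coe_sdiff,
        Finset.coe_filter, Finset.mem_range, Finset.coe_range, Set.mem_sdiff, Set.mem_Iio]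
      omega
    have h2 : ((Finset.range (N + 1)).filter fun ℓ => Nat.gcd k ℓ = 1).card =
        Nat.count (fun ℓ => Nat.gcd k ℓ = 1) (N + 1) := by
      rw [Nat.count_eq_card_filter_range]
    have h3 := Nat.count_monotone (fun ℓ => Nat.gcd k ℓ = 1)
      (show N / k * k ≤ N + 1 by have := Nat.div_mul_le_self N k; omega)
    have h4 := Nat.count_monotone (fun ℓ => Nat.gcd k ℓ = 1)
      (show N + 1 ≤ (N / k + 1) * k by
        have := Nat.lt_mul_div_succ N hk
        rw [mul_comm] at this
        exact this)
    rw [count_coprime_mul, ← hφ] at h3 h4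
    rw [h1, Set.ncard_coe_finset]
    have h5 := Finset.card_le_card (Finset.sdiff_subset
      (s := (Finset.range (N + 1)).filter fun ℓ => Nat.gcd k ℓ = 1) (t := Finset.range C))
    have h6 := Finset.le_card_sdiff (Finset.range C)
      ((Finset.range (N + 1)).filter fun ℓ => Nat.gcd k ℓ = 1)
    rw [Finset.card_range] at h6
    omega
  have hlow : Tendsto (fun N : ℕ => (φ : ℝ) / k - ((φ : ℝ) + C) / N) atTop (𝓝 ((φ : ℝ) / k)) := by
    simpa using (tendsto_const_nhds (x := (φ : ℝ) / k)).sub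
      (tendsto_const_div_atTop_nhds_zero_nat ((φ : ℝ) + C))
  have hup : Tendsto (fun N : ℕ => (φ : ℝ) / k + (φ : ℝ) / N) atTop (𝓝 ((φ : ℝ) / k)) := by
    simpa using (tendsto_const_nhds (x := (φ : ℝ) / k)).add
      (tendsto_const_div_atTop_nhds_zero_nat (φ : ℝ))
  refine tendsto_of_tendsto_of_tendsto_of_le_of_le' hlow hup ?_ ?_
  · filter_upwards [eventually_gt_atTop 0] with N hN
    have hNr : (0 : ℝ) < N := by exact_mod_cast hN
    have h1 : ((N / k : ℕ) : ℝ) * φ ≤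
        (({ℓ : ℕ | C ≤ ℓ ∧ Nat.gcd k ℓ = 1} ∩ Set.Icc 1 N).ncard : ℝ) + C := by
      exact_mod_cast (hbounds N).2
    have h2 : (N : ℝ) / k < (N / k : ℕ) + 1 := by
      rw [div_lt_iff₀ hkr]
      have := Nat.lt_mul_div_succ N hk
      rw [mul_comm] at this
      exact_mod_cast this
    rw [le_div_iff₀ hNr, sub_mul, div_mul_cancel₀ _ hNr.ne']
    have h3 : (φ : ℝ) / k * N = N / k * φ := by ring
    have h4 : (N : ℝ) / k * φ ≤ ((N / k : ℕ) + 1) * φ := by gcongr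
    linarith
  · filter_upwards [eventually_gt_atTop 0] with N hN
    have hNr : (0 : ℝ) < N := by exact_mod_cast hN
    have h1 : (({ℓ : ℕ | C ≤ ℓ ∧ Nat.gcd k ℓ = 1} ∩ Set.Icc 1 N).ncard : ℝ) ≤
        ((N / k : ℕ) + 1) * φ := by exact_mod_cast (hbounds N).1
    have h2 : ((N / k : ℕ) : ℝ) ≤ N / k := Nat.cast_div_le
    rw [div_le_iff₀ hNr, add_mul, div_mul_cancel₀ _ hNr.ne']
    have h3 : (φ : ℝ) / k * N = N / k * φ := by ring
    have h4 : ((N / k : ℕ) : ℝ) * φ ≤ N / k * φ := by gcongr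
    linarith

end NaturalDensity

/-! ### Arithmetic of the special uniformities and conclusion. -/

/-- The divisors `d = k / gcd k ℓ` that occur for the special values of `k`. -/
theorem third_condition {k ℓ : ℕ}
    (hform : (∃ α β : ℕ, k = 2 ^ α * 3 ^ β) ∨ (∃ q : ℕ, q.Prime ∧ k = 2 * q) ∨
      (∃ q : ℕ, q.Prime ∧ k = 3 * q)) (hkℓ : ¬ k ∣ ℓ) (hd : ¬ 2 ∣ k / Nat.gcd k ℓ) :
    3 ∣ k / Nat.gcd k ℓ ∨ (Nat.gcd k ℓ ≤ 3 ∧ 3 < k / Nat.gcd k ℓ) := by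
  have hgk : k / Nat.gcd k ℓ * Nat.gcd k ℓ = k := Nat.div_mul_cancel (Nat.gcd_dvd_left k ℓ)
  have hgℓ := Nat.gcd_dvd_right k ℓ
  set g := Nat.gcd k ℓ with hg
  set d := k / g with hdef
  have hd1 : d ≠ 1 := by
    intro h
    rw [h, one_mul] at hgk
    exact hkℓ (hgk ▸ hgℓ)
  have hdk : d ∣ k := ⟨g, hgk.symm⟩
  have c2 : Nat.Coprime d 2 := ((Nat.Prime.coprime_iff_not_dvd Nat.prime_two).2 hd).symm
  by_cases h3 : 3 ∣ d
  · exact Or.inl h3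
  have c3 : Nat.Coprime d 3 := ((Nat.Prime.coprime_iff_not_dvd Nat.prime_three).2 h3).symm
  right
  -- Coprime to `r`, `d` divides the prime `q` and is not 1, so `d = q` and `g = r`; divisibility by
  -- neither 2 nor 3 gives `3 < d`.
  have finish : ∀ q r : ℕ, q.Prime → r ≤ 3 → k = r * q → Nat.Coprime d r → g ≤ 3 ∧ 3 < d := by
    intro q r hq hr hkq hc
    have hdq : d ∣ q := hc.dvd_of_dvd_mul_left (hkq ▸ hdk)
    have hdq' : d = q := ((Nat.dvd_prime hq).1 hdq).resolve_left hd1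
    have h2 := hq.two_le
    have hgr : g = r := by
      refine Nat.eq_of_mul_eq_mul_left (by omega : 0 < d) ?_
      rw [hgk, hkq, hdq', mul_comm]
    refine ⟨by omega, ?_⟩
    have : d ≠ 2 := fun h => hd (by rw [h])
    have : d ≠ 3 := fun h => h3 (by rw [h])
    omega
  rcases hform with ⟨α, β, h⟩ | ⟨q, hq, h⟩ | ⟨q, hq, h⟩
  -- A divisor of 2^α 3^β coprime to 2 and 3 is 1, which would mean `k ∣ ℓ`.
  · have h4 : d ∣ 1 := by
      have h5 : d ∣ 2 ^ α * 3 ^ β := h ▸ hdk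
      have h6 : d ∣ 3 ^ β := (c2.pow_right α).dvd_of_dvd_mul_left h5
      have h7 : Nat.Coprime d (3 ^ β) := c3.pow_right β
      rw [← h7.gcd_eq_one]
      exact Nat.dvd_gcd dvd_rfl h6
    exact absurd (Nat.dvd_one.1 h4) hd1
  · exact finish q 2 hq (by norm_num) h c2
  · exact finish q 3 hq le_rfl h c3

theorem corollary1p4 :
    -- (a)
    (∀ k : ℕ, k.Prime → 3 ≤ k → ∀ ℓ : ℕ, 20 * k ^ 2 ≤ ℓ → ¬ k ∣ ℓ →
      (KGraph.tightCycle k ℓ).HasCodegreeTuranDensity (1 / 3)) ∧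
    -- (b)
    (∀ k : ℕ, 3 ≤ k →
      ((∃ α β : ℕ, k = 2 ^ α * 3 ^ β) ∨ (∃ q : ℕ, q.Prime ∧ k = 2 * q) ∨
        (∃ q : ℕ, q.Prime ∧ k = 3 * q)) →
      ∀ ℓ : ℕ, 20 * k ^ 2 ≤ ℓ → ¬ k ∣ ℓ →
        (KGraph.tightCycle k ℓ).HasCodegreeTuranDensity
          (if 2 ∣ k / Nat.gcd k ℓ then 1 / 2 else 1 / 3)) ∧
    -- (c)
    (∀ k : ℕ, 3 ≤ k →
      HasNaturalDensity {ℓ : ℕ | 20 * k ^ 2 ≤ ℓ ∧ Nat.gcd k ℓ = 1}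
        ((Nat.totient k : ℝ) / (k : ℝ)) ∧
      ∀ ℓ : ℕ, 20 * k ^ 2 ≤ ℓ → Nat.gcd k ℓ = 1 →
        ¬ k ∣ ℓ ∧
        (KGraph.tightCycle k ℓ).HasCodegreeTuranDensity
          (if Even k then 1 / 2 else 1 / 3)) := by
  have coprime_case : ∀ k ℓ : ℕ, 3 ≤ k → 20 * k ^ 2 ≤ ℓ → Nat.gcd k ℓ = 1 → Odd k →
      (KGraph.tightCycle k ℓ).HasCodegreeTuranDensity (1 / 3) := by
    intro k ℓ hk hℓ hg hodd
    have hd : k / Nat.gcd k ℓ = k := by rw [hg, Nat.div_one]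
    refine KGraph.hasCodegreeTuranDensity_third hk hℓ (by rwa [hd]) ?_
    rw [hd, hg]
    rcases Nat.eq_or_lt_of_le hk with rfl | h
    · exact Or.inl dvd_rfl
    · exact Or.inr ⟨by norm_num, h⟩
  refine ⟨?_, ?_, ?_⟩
  · intro k hp hk ℓ hℓ hkℓ
    exact coprime_case k ℓ hk hℓ ((Nat.Prime.coprime_iff_not_dvd hp).2 hkℓ)
      (hp.odd_of_ne_two (by omega))
  · intro k hk hform ℓ hℓ hkℓ
    split_ifs with hd
    · exact KGraph.hasCodegreeTuranDensity_half hk hℓ hd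
    · exact KGraph.hasCodegreeTuranDensity_third hk hℓ
        (Nat.not_even_iff_odd.1 fun h => hd h.two_dvd) (third_condition hform hkℓ hd)
  · intro k hk
    refine ⟨hasNaturalDensity_coprime (by omega) _ (by positivity), fun ℓ hℓ hg => ⟨?_, ?_⟩⟩
    · intro h
      rw [Nat.gcd_eq_left h] at hg
      omega
    · split_ifs with he
      · exact KGraph.hasCodegreeTuranDensity_half hk hℓ (by rw [hg, Nat.div_one]; exact he.two_dvd)
      · exact coprime_case k ℓ hk hℓ hg (Nat.not_even_iff_odd.1 he)
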